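/- Let $d>0$ and $\delta>0$, let $\Omega=\mathbb{R}\times(0,d)$ and let $$\mathcal{D}=\{\langle x,0\rangle : x<-\delta\}\cup\{\langle x,d\rangle : x>\delta\}\subset\partial\Omega .$$ Let $H^1(\Omega)=\{f\in L^2(\Omega)\,:\,\nabla f\in L^2(\Omega)\}$ (complex-valued functions, distributional gradient) with the norm $\|f\|_{H^1(\Omega)}^2=\|f\|_{L^2(\Omega)}^2+\|\nabla f\|_{L^2(\Omega)}^2$. Let $f\mapsto f\upharpoonright\partial\Omega$, $H^1(\Omega)\to L^2(\partial\Omega)$, be the trace operator, i.e. the continuous extension to $H^1(\Omega)$ of the map which sends the restriction to $\Omega$ of a function $\tilde\psi\in C_0^\infty(\mathbb{R}^2)$ to the restriction of $\tilde\psi$ to $\partial\Omega$. Put $$Q^A(q_0)=\{f\in H^1(\Omega) : f\upharpoonright\mathcal{D}=0\},$$ where $f\upharpoonright\mathcal{D}=0$ means that the trace of $f$ vanishes almost everywhere on $\mathcal{D}$ with respect to arc length. Then the set $$\tilde Q(\Omega)=\bigl\{\tilde\psi\upharpoonright\Omega \;:\; \tilde\psi\in C_0^\infty(\mathbb{R}^2),\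 \tilde\psi(p)=0\text{ for all } p\in\mathcal{D}\bigr\}$$ is dense in $Q^A(q_0)$ with respect to the $H^1(\Omega)$ norm; that is, $\tilde Q(\Omega)\subseteq Q^A(q_0)$, and for every $f\in Q^A(q_0)$ and every $\varepsilon>0$ there is $\psi\in\tilde Q(\Omega)$ with $\|f-\psi\|_{H^1(\Omega)}<\varepsilon$. -/

import Mathlib

open MeasureTheory Set
open scoped ContDiff

noncomputable section

namespace Waveguide

/-- The space `C₀^∞(ℝ²)` of smooth, compactly supported, complex-valued functions on the plane. -/
def testFunctions : Submodule ℂ (ℝ × ℝ → ℂ) where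
  carrier := {φ | ContDiff ℝ ∞ φ ∧ HasCompactSupport φ}
  add_mem' := fun hφ hψ => ⟨hφ.1.add hψ.1, hφ.2.add hψ.2⟩
  zero_mem' := ⟨contDiff_const, HasCompactSupport.zero⟩
  smul_mem' := fun c _ hφ => ⟨contDiff_const.smul hφ.1, hφ.2.smul_left (f := fun _ => c)⟩

/-- The partial derivative of a function on the plane in the direction `v`. -/
def pderiv (v : ℝ × ℝ) (φ : ℝ × ℝ → ℂ) : ℝ × ℝ → ℂ := fun p => fderiv ℝ φ p v

/-- The direction `(1, 0)` of the variable `x`. -/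
def dirX : ℝ × ℝ := (1, 0)

/-- The direction `(0, 1)` of the variable `y`. -/
def dirY : ℝ × ℝ := (0, 1)

lemma testFunctions.contDiff {φ : ℝ × ℝ → ℂ} (hφ : φ ∈ testFunctions) : ContDiff ℝ ∞ φ := hφ.1

lemma testFunctions.hasCompactSupport {φ : ℝ × ℝ → ℂ} (hφ : φ ∈ testFunctions) :
    HasCompactSupport φ := hφ.2

lemma testFunctions.differentiable {φ : ℝ × ℝ → ℂ} (hφ : φ ∈ testFunctions) :
    Differentiable ℝ φ := hφ.1.differentiable (by simp)

lemma testFunctions.pderiv_mem {φ : ℝ × ℝ → ℂ} (hφ : φ ∈ testFunctions) (v : ℝ × ℝ) :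
    pderiv v φ ∈ testFunctions :=
  ⟨(hφ.1.fderiv_right (m := ∞) (by simp)).clm_apply contDiff_const,
    hφ.2.fderiv_apply ℝ v⟩

lemma testFunctions.memLp {φ : ℝ × ℝ → ℂ} (hφ : φ ∈ testFunctions) (μ : Measure (ℝ × ℝ))
    [IsFiniteMeasureOnCompacts μ] : MemLp φ 2 μ :=
  hφ.1.continuous.memLp_of_hasCompactSupport hφ.2

lemma testFunctions.integrable_mul {φ : ℝ × ℝ → ℂ} (hφ : φ ∈ testFunctions)
    {μ : Measure (ℝ × ℝ)} [IsFiniteMeasureOnCompacts μ] (f : Lp ℂ 2 μ) :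
    Integrable (fun p => f p * φ p) μ :=
  (Lp.memLp f).integrable_mul (testFunctions.memLp hφ μ)

/-- `g` is the weak partial derivative of `f` on `Ω` in the direction `v`:
`∫_Ω f ∂ᵥφ = - ∫_Ω g φ` for all `φ ∈ C₀^∞(Ω)`. -/
def IsWeakDeriv (Ω : Set (ℝ × ℝ)) (v : ℝ × ℝ) (f g : Lp ℂ 2 (volume.restrict Ω)) : Prop :=
  ∀ φ ∈ testFunctions, tsupport φ ⊆ Ω →
    ∫ p in Ω, f p * pderiv v φ p = -∫ p in Ω, g p * φ p

lemma IsWeakDeriv.add {Ω : Set (ℝ × ℝ)} {v : ℝ × ℝ} {f g f' g' : Lp ℂ 2 (volume.restrict Ω)}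
    (h : IsWeakDeriv Ω v f g) (h' : IsWeakDeriv Ω v f' g') :
    IsWeakDeriv Ω v (f + f') (g + g') := by
  intro φ hφ hs
  have h1 : ∫ p in Ω, (f + f') p * pderiv v φ p
      = (∫ p in Ω, f p * pderiv v φ p) + ∫ p in Ω, f' p * pderiv v φ p := by
    rw [← integral_add (testFunctions.integrable_mul (testFunctions.pderiv_mem hφ v) f)
      (testFunctions.integrable_mul (testFunctions.pderiv_mem hφ v) f')]
    refine integral_congr_ae ?_
    filter_upwards [Lp.coeFn_add f f'] with p hp
    rw [hp, Pi.add_apply, add_mul]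
  have h2 : ∫ p in Ω, (g + g') p * φ p
      = (∫ p in Ω, g p * φ p) + ∫ p in Ω, g' p * φ p := by
    rw [← integral_add (testFunctions.integrable_mul hφ g)
      (testFunctions.integrable_mul hφ g')]
    refine integral_congr_ae ?_
    filter_upwards [Lp.coeFn_add g g'] with p hp
    rw [hp, Pi.add_apply, add_mul]
  rw [h1, h2, h φ hφ hs, h' φ hφ hs, neg_add]

lemma IsWeakDeriv.smul {Ω : Set (ℝ × ℝ)} {v : ℝ × ℝ} (c : ℂ)
    {f g : Lp ℂ 2 (volume.restrict Ω)} (h : IsWeakDeriv Ω v f g) :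
    IsWeakDeriv Ω v (c • f) (c • g) := by
  intro φ hφ hs
  have h1 : ∫ p in Ω, (c • f) p * pderiv v φ p = c * ∫ p in Ω, f p * pderiv v φ p := by
    rw [← integral_const_mul]
    refine integral_congr_ae ?_
    filter_upwards [Lp.coeFn_smul c f] with p hp
    rw [hp, Pi.smul_apply, smul_eq_mul, mul_assoc]
  have h2 : ∫ p in Ω, (c • g) p * φ p = c * ∫ p in Ω, g p * φ p := by
    rw [← integral_const_mul]
    refine integral_congr_ae ?_
    filter_upwards [Lp.coeFn_smul c g] with p hp
    rw [hp, Pi.smul_apply, smul_eq_mul, mul_assoc]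
  rw [h1, h2, h φ hφ hs, mul_neg]

lemma IsWeakDeriv.zero (Ω : Set (ℝ × ℝ)) (v : ℝ × ℝ) : IsWeakDeriv Ω v 0 0 := by
  intro φ _ _
  have h0 : ∀ ψ : ℝ × ℝ → ℂ, ∫ p in Ω, (0 : Lp ℂ 2 (volume.restrict Ω)) p * ψ p = 0 := by
    intro ψ
    rw [← integral_zero (ℝ × ℝ) ℂ]
    refine integral_congr_ae ?_
    filter_upwards [Lp.coeFn_zero ℂ 2 (volume.restrict Ω)] with p hp
    rw [hp, Pi.zero_apply, zero_mul]
  rw [h0, h0, neg_zero]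

/-- The Sobolev space `H¹(Ω)`: a function `f ∈ L²(Ω)` (component `0`) is stored together with its
weak partial derivatives `∂f/∂x` (component `1`) and `∂f/∂y` (component `2`), which have to exist
and to lie in `L²(Ω)`. The inherited norm is the usual one,
`‖f‖² + ‖∂f/∂x‖² + ‖∂f/∂y‖²` being its square. -/
def H1 (Ω : Set (ℝ × ℝ)) :
    Submodule ℂ (PiLp 2 (fun _ : Fin 3 => Lp ℂ 2 (volume.restrict Ω))) where
  carrier := {u | IsWeakDeriv Ω dirX (u 0) (u 1) ∧ IsWeakDeriv Ω dirY (u 0) (u 2)}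
  add_mem' := fun hu hw => ⟨hu.1.add hw.1, hu.2.add hw.2⟩
  zero_mem' := ⟨IsWeakDeriv.zero Ω dirX, IsWeakDeriv.zero Ω dirY⟩
  smul_mem' := fun c _ hu => ⟨hu.1.smul c, hu.2.smul c⟩

/-- The restriction of `C₀^∞(ℝ²)` functions to `L²(μ)`. -/
def toL2 (μ : Measure (ℝ × ℝ)) [IsFiniteMeasureOnCompacts μ] :
    testFunctions →ₗ[ℂ] Lp ℂ 2 μ where
  toFun φ := (testFunctions.memLp φ.2 μ).toLp φ.1
  map_add' _ _ := rfl
  map_smul' _ _ := rfl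

/-- The classical partial derivative of a `C₀^∞(ℝ²)` function is its weak derivative. -/
lemma isWeakDeriv_toL2 (Ω : Set (ℝ × ℝ)) (v : ℝ × ℝ) (ψ : testFunctions) :
    IsWeakDeriv Ω v (toL2 (volume.restrict Ω) ψ)
      (toL2 (volume.restrict Ω) ⟨pderiv v ψ, testFunctions.pderiv_mem ψ.2 v⟩) := by
  intro φ hφ hs
  have key : ∀ (χ : testFunctions) (η : ℝ × ℝ → ℂ), (∀ p, p ∉ Ω → η p = 0) →
      ∫ p in Ω, toL2 (volume.restrict Ω) χ p * η p = ∫ p, χ.1 p * η p := by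
    intro χ η hη
    have hset : ∫ p in Ω, χ.1 p * η p = ∫ p, χ.1 p * η p :=
      setIntegral_eq_integral_of_forall_compl_eq_zero (fun p hp => by rw [hη p hp, mul_zero])
    rw [← hset]
    refine integral_congr_ae ?_
    filter_upwards [(testFunctions.memLp χ.2 (volume.restrict Ω)).coeFn_toLp] with p hp
    change ((testFunctions.memLp χ.2 (volume.restrict Ω)).toLp χ.1 : ℝ × ℝ → ℂ) p * η p = _
    rw [hp]
  have hint : ∀ f g : ℝ × ℝ → ℂ, f ∈ testFunctions → g ∈ testFunctions →
      Integrable (fun p => f p * g p) := fun f g hf hg =>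
    (testFunctions.memLp hf volume).integrable_mul (testFunctions.memLp hg volume)
  have hz : ∀ p, p ∉ Ω → pderiv v φ p = 0 := fun p hp => by
    have : p ∉ tsupport (pderiv v φ) := fun h => hp (hs (tsupport_fderiv_apply_subset ℝ v h))
    exact image_eq_zero_of_notMem_tsupport this
  rw [key _ _ hz,
    key _ _ (fun p hp => image_eq_zero_of_notMem_tsupport fun h => hp (hs h))]
  exact integral_mul_fderiv_eq_neg_fderiv_mul_of_integrable
    (hint _ _ (testFunctions.pderiv_mem ψ.2 v) hφ)
    (hint _ _ ψ.2 (testFunctions.pderiv_mem hφ v)) (hint _ _ ψ.2 hφ)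
    (fun p _ => testFunctions.differentiable ψ.2 p) (fun p _ => testFunctions.differentiable hφ p)

/-- The restriction `ψ ↦ ψ↾Ω` of `C₀^∞(ℝ²)` functions to `Ω`, as a map into `H¹(Ω)`. -/
def toH1 (Ω : Set (ℝ × ℝ)) : testFunctions →ₗ[ℂ] H1 Ω where
  toFun ψ := ⟨WithLp.toLp 2 ![toL2 (volume.restrict Ω) ψ,
      toL2 (volume.restrict Ω) ⟨pderiv dirX ψ, testFunctions.pderiv_mem ψ.2 dirX⟩,
      toL2 (volume.restrict Ω) ⟨pderiv dirY ψ, testFunctions.pderiv_mem ψ.2 dirY⟩],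
    isWeakDeriv_toL2 Ω dirX ψ, isWeakDeriv_toL2 Ω dirY ψ⟩
  map_add' φ ψ := by
    have h : ∀ v, (⟨pderiv v (φ + ψ : testFunctions),
          testFunctions.pderiv_mem (φ + ψ).2 v⟩ : testFunctions)
        = ⟨pderiv v φ, testFunctions.pderiv_mem φ.2 v⟩
          + ⟨pderiv v ψ, testFunctions.pderiv_mem ψ.2 v⟩ := by
      intro v
      refine Subtype.ext (funext fun p => ?_)
      change fderiv ℝ ((φ : ℝ × ℝ → ℂ) + (ψ : ℝ × ℝ → ℂ)) p v = fderiv ℝ φ p v + fderiv ℝ ψ p v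
      rw [fderiv_add (testFunctions.differentiable φ.2 p) (testFunctions.differentiable ψ.2 p)]
      rfl
    refine Subtype.ext (PiLp.ext fun i => ?_)
    fin_cases i
    · exact map_add (toL2 (volume.restrict Ω)) φ ψ
    · exact (congrArg _ (h dirX)).trans (map_add (toL2 (volume.restrict Ω)) _ _)
    · exact (congrArg _ (h dirY)).trans (map_add (toL2 (volume.restrict Ω)) _ _)
  map_smul' c ψ := by
    have h : ∀ v, (⟨pderiv v (c • ψ : testFunctions),
          testFunctions.pderiv_mem (c • ψ).2 v⟩ : testFunctions)
        = c • ⟨pderiv v ψ, testFunctions.pderiv_mem ψ.2 v⟩ := by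
      intro v
      refine Subtype.ext (funext fun p => ?_)
      change fderiv ℝ (c • (ψ : ℝ × ℝ → ℂ)) p v = c • fderiv ℝ ψ p v
      rw [fderiv_const_smul (testFunctions.differentiable ψ.2 p)]
      rfl
    refine Subtype.ext (PiLp.ext fun i => ?_)
    fin_cases i
    · exact map_smul (toL2 (volume.restrict Ω)) c ψ
    · exact (congrArg _ (h dirX)).trans (map_smul (toL2 (volume.restrict Ω)) c _)
    · exact (congrArg _ (h dirY)).trans (map_smul (toL2 (volume.restrict Ω)) c _)

/-- The strip `Ω = ℝ × (0, d)`. -/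
def strip (d : ℝ) : Set (ℝ × ℝ) := univ ×ˢ Ioo 0 d

/-- The arc length measure on the boundary `∂Ω = (ℝ × {0}) ∪ (ℝ × {d})` of the strip. -/
def boundaryMeasure (d : ℝ) : Measure (ℝ × ℝ) :=
  (volume : Measure ℝ).prod (Measure.dirac 0 + Measure.dirac d)

instance (d : ℝ) : IsFiniteMeasureOnCompacts (boundaryMeasure d) := by
  unfold boundaryMeasure; infer_instance

/-- The trace operator `H¹(Ω) → L²(∂Ω)` of the strip: the extension by continuity, from the
restrictions to `Ω` of `C₀^∞(ℝ²)` functions (which are dense in `H¹(Ω)`) to all of `H¹(Ω)`, of the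
map `ψ↾Ω ↦ ψ↾∂Ω` (which is bounded from the `H¹(Ω)` norm to the `L²(∂Ω)` norm). -/
def trace (d : ℝ) : H1 (strip d) →L[ℂ] Lp ℂ 2 (boundaryMeasure d) :=
  (toL2 (boundaryMeasure d)).extendOfNorm (toH1 (strip d))

/-- The Dirichlet part `𝒟 = {(x, 0) | x < -δ} ∪ {(x, d) | x > δ}` of `∂Ω` in configuration A. -/
def dirichletA (d δ : ℝ) : Set (ℝ × ℝ) := {p | p.1 < -δ ∧ p.2 = 0} ∪ {p | δ < p.1 ∧ p.2 = d}

/-- The form domain `Q^A(q₀) = {f ∈ H¹(Ω) | f↾𝒟 = 0}`: the trace vanishes a.e. on `𝒟`. -/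
def formDomainA (d δ : ℝ) : Set (H1 (strip d)) :=
  {f | ∀ᵐ p ∂(boundaryMeasure d), p ∈ dirichletA d δ → trace d f p = 0}

/-- The set of restrictions to `Ω` of `C₀^∞(ℝ²)` functions that vanish on `𝒟`. -/
def smoothCoreA (d δ : ℝ) : Set (H1 (strip d)) :=
  {f | ∃ ψ : testFunctions, (∀ p ∈ dirichletA d δ, (ψ : ℝ × ℝ → ℂ) p = 0) ∧
    toH1 (strip d) ψ = f}

end Waveguide

end

/-! The proof is by duality. `H1 Ω` sits in the Hilbert space `L²(Ω)³`, so `f` lies in the closure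
of the smooth core once every triple `W` annihilating the jets of the core also annihilates `(f,
∂ₓf, ∂ᵧf)`. Approximants are never estimated in norm.

For a cutoff `m`, let `Λ(q)` pair `W` with the translate by `q` of the product-rule triple of `m f`,
extended by zero; this is `pairing`. By Fubini, `∫ ρ Λ` is the pairing of `W` with the mollification
of this triple by `ρ`. If for all `ρ` supported in an open set `S` the mollification of `m f` is
admissible and has the mollified derivatives on `Ω`, then `Λ` vanishes on `S`, and by continuity of
translation in `L²` on the closure of `S` (`pairing_eq_zero`). Hence one-sided kernels suffice: the
translation of interest need only be a boundary point of `S`.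

Two mechanisms give correct derivatives. Away from one edge, kernels sampling towards the interior
only see points of the strip, where the weak derivative is available. Near the Dirichlet part,
vanishing of the trace removes the boundary term in Green's formula, so the zero extension is itself
weakly differentiable there. Kernels sampling from outside then produce functions vanishing on that
part.

At the junction of Dirichlet and Neumann parts both are combined after a horizontal shift by `t`
which enlarges the zone where the translate of `f` vanishes. This leaves room to cut `m` into a
piece vanishing on the Neumann part of its edge and a piece whose shifted mollifications vanish on
the Dirichlet part. Both pieces have pairing zero at the same shift vector, so their sum does; then
`t → 0` (`pairing_lower_eq_zero`, `pairing_upper_eq_zero`).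

Green's formula with trace term needs density of smooth functions in `H¹` of the strip. The same
duality argument gives it, with no boundary condition imposed. -/

noncomputable section

namespace Waveguide

open Filter Topology

/-! ### Correlations and mollification -/

/-- The bilinear correlation `q ↦ ∫ w(p) G(p - q) dp` of two functions on the plane. -/
def correlation (w G : ℝ × ℝ → ℂ) (q : ℝ × ℝ) : ℂ := ∫ p, w p * G (p - q)

lemma memLp_two_comp_sub {G : ℝ × ℝ → ℂ} (hG : MemLp G 2) (q : ℝ × ℝ) :
    MemLp (fun p => G (p - q)) 2 :=
  hG.comp_measurePreserving (measurePreserving_sub_right volume q)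

/-- Translation is strongly continuous on `L²`, and the correlation is the inner product of a fixed
vector with a translate. The conjugate of `w` cancels the one in the inner product. -/
lemma continuous_correlation {w G : ℝ × ℝ → ℂ} (hw : MemLp w 2) (hG : MemLp G 2) :
    Continuous (correlation w G) := by
  have hw' : MemLp (fun p => (starRingEnd ℂ) (w p)) 2 := hw.star
  let τ : ℝ × ℝ → C(ℝ × ℝ, ℝ × ℝ) := fun q => ⟨fun p => p - q, by fun_prop⟩
  have hτc : Continuous τ :=
    ContinuousMap.continuous_of_continuous_uncurry _ (by
      change Continuous fun z : (ℝ × ℝ) × (ℝ × ℝ) => z.2 - z.1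
      fun_prop)
  have hτ : ∀ q, MeasurePreserving (τ q) (volume : Measure (ℝ × ℝ)) volume :=
    fun q => measurePreserving_sub_right volume q
  have hc : Continuous fun q => Lp.compMeasurePreserving (τ q) (hτ q) (hG.toLp G) :=
    continuous_const.compMeasurePreservingLp hτc hτ (by simp)
  have h : correlation w G = fun q =>
      inner ℂ (hw'.toLp _) (Lp.compMeasurePreserving (τ q) (hτ q) (hG.toLp G)) := by
    funext q
    rw [L2.inner_def, correlation]
    refine integral_congr_ae ?_
    filter_upwards [hw'.coeFn_toLp, Lp.coeFn_compMeasurePreserving (hG.toLp G) (hτ q),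
      (hτ q).quasiMeasurePreserving.ae_eq_comp hG.coeFn_toLp] with p h1 h2 h3
    rw [h1, h2, h3]
    simp [τ, mul_comm]
  rw [h]
  exact continuous_const.inner hc

/-- Fubini after substituting `p - q` for `q`. Absolute convergence follows from `|w| |ρ| |G| ≤ |ρ|
(|w|² + |G|²)`, a sum of two integrable functions on the product. -/
lemma integral_mul_convolution {w G ρ : ℝ × ℝ → ℂ} (hw : MemLp w 2) (hG : MemLp G 2)
    (hρ : ρ ∈ testFunctions) :
    ∫ p, w p * ∫ q, G q * ρ (p - q) = ∫ q, ρ q * correlation w G q := by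
  have hρi : Integrable ρ := hρ.1.continuous.integrable_of_hasCompactSupport hρ.2
  have h1 : Integrable (fun z : (ℝ × ℝ) × (ℝ × ℝ) => ‖w z.1‖ ^ 2 * ‖ρ z.2‖)
      ((volume : Measure (ℝ × ℝ)).prod volume) :=
    Integrable.mul_prod hw.norm.integrable_sq hρi.norm
  have h2 : Integrable (fun z : (ℝ × ℝ) × (ℝ × ℝ) => ‖ρ z.2‖ * ‖G (z.1 - z.2)‖ ^ 2)
      ((volume : Measure (ℝ × ℝ)).prod volume) :=
    hρi.norm.convolution_integrand (ContinuousLinearMap.mul ℝ ℝ) hG.norm.integrable_sq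
  have hm : AEStronglyMeasurable
      (fun z : (ℝ × ℝ) × (ℝ × ℝ) => w z.1 * (ρ z.2 * G (z.1 - z.2)))
      ((volume : Measure (ℝ × ℝ)).prod volume) :=
    hw.1.comp_fst.mul
      (hρi.aestronglyMeasurable.convolution_integrand (ContinuousLinearMap.mul ℝ ℂ) hG.1)
  have hint : Integrable (fun z : (ℝ × ℝ) × (ℝ × ℝ) => w z.1 * (ρ z.2 * G (z.1 - z.2)))
      ((volume : Measure (ℝ × ℝ)).prod volume) := by
    refine (h1.add h2).mono' hm (ae_of_all _ fun z => ?_)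
    simp only [norm_mul, Pi.add_apply]
    nlinarith [mul_nonneg (norm_nonneg (ρ z.2)) (sq_nonneg (‖w z.1‖ - ‖G (z.1 - z.2)‖)),
      mul_nonneg (norm_nonneg (ρ z.2)) (sq_nonneg ‖w z.1‖),
      mul_nonneg (norm_nonneg (ρ z.2)) (sq_nonneg ‖G (z.1 - z.2)‖)]
  have h3 : ∀ p, w p * ∫ q, G q * ρ (p - q) = ∫ q, w p * (ρ q * G (p - q)) := by
    intro p
    rw [← integral_sub_left_eq_self (fun q => G q * ρ (p - q)) volume p, ← integral_const_mul]
    simp [mul_comm]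
  simp_rw [h3]
  rw [integral_integral_swap hint]
  refine integral_congr_ae (ae_of_all _ fun q => ?_)
  simp only [correlation]
  rw [← integral_const_mul]
  refine integral_congr_ae (ae_of_all _ fun p => ?_)
  ring

/-- A continuous function on the plane which annihilates all test functions supported in an open
set vanishes on the closure of that set. -/
lemma eq_zero_on_closure_of_forall_integral {Λ : ℝ × ℝ → ℂ} (hΛ : Continuous Λ)
    {S : Set (ℝ × ℝ)} (hS : IsOpen S)
    (h : ∀ ρ ∈ testFunctions, tsupport ρ ⊆ S → ∫ q, ρ q * Λ q = 0) :
    ∀ q ∈ closure S, Λ q = 0 := by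
  have h0 : ∀ᵐ q, q ∈ S → Λ q = 0 := by
    refine hS.ae_eq_zero_of_integral_contDiff_smul_eq_zero
      (hΛ.locallyIntegrable.locallyIntegrableOn S) fun g hg hgc hgS => ?_
    have := h (fun x => (g x : ℂ)) ⟨Complex.ofRealCLM.contDiff.comp hg,
      hgc.comp_left (g := ((↑) : ℝ → ℂ)) (by simp)⟩
      ((closure_mono (Function.support_comp_subset (g := ((↑) : ℝ → ℂ)) (by simp) g)).trans hgS)
    simpa using this
  have h1 : EqOn Λ (fun _ => 0) S := by
    refine Measure.eqOn_open_of_ae_eq (μ := volume) ?_ hS hΛ.continuousOn continuousOn_const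
    exact (ae_restrict_iff' hS.measurableSet).2 h0
  exact h1.closure hΛ continuous_const

lemma testFunctions.comp_const_sub {ρ : ℝ × ℝ → ℂ} (hρ : ρ ∈ testFunctions) (p : ℝ × ℝ) :
    (fun q => ρ (p - q)) ∈ testFunctions :=
  ⟨hρ.1.comp (contDiff_const.sub contDiff_id),
    hρ.2.comp_homeomorph (Homeomorph.subLeft p)⟩

lemma testFunctions.mul {m φ : ℝ × ℝ → ℂ} (hm : m ∈ testFunctions) (hφ : ContDiff ℝ ∞ φ) :
    (fun q => m q * φ q) ∈ testFunctions :=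
  ⟨hm.1.mul hφ, hm.2.mul_right⟩

lemma pderiv_mul {m φ : ℝ × ℝ → ℂ} (hm : Differentiable ℝ m) (hφ : Differentiable ℝ φ)
    (v p : ℝ × ℝ) :
    pderiv v (fun q => m q * φ q) p = m p * pderiv v φ p + pderiv v m p * φ p := by
  simp only [pderiv]
  rw [fderiv_fun_mul (hm p) (hφ p)]
  simp [mul_comm]

lemma pderiv_comp_const_sub {ρ : ℝ × ℝ → ℂ} (hρ : Differentiable ℝ ρ) (v p q : ℝ × ℝ) :
    pderiv v (fun q => ρ (p - q)) q = -pderiv v ρ (p - q) := by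
  simp only [pderiv]
  have h : HasFDerivAt (fun q : ℝ × ℝ => p - q) (-ContinuousLinearMap.id ℝ (ℝ × ℝ)) q :=
    (hasFDerivAt_id q).const_sub p
  have h' : HasFDerivAt (fun q => ρ (p - q)) _ q := (hρ (p - q)).hasFDerivAt.comp q h
  rw [h'.fderiv]
  simp

/-- The convolution `p ↦ ∫ G(q) ρ(p - q) dq`. -/
def mollify (G ρ : ℝ × ℝ → ℂ) (p : ℝ × ℝ) : ℂ := ∫ q, G q * ρ (p - q)

lemma mollify_eq_convolution (G ρ : ℝ × ℝ → ℂ) :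
    mollify G ρ = convolution G ρ (ContinuousLinearMap.mul ℝ ℂ) volume := rfl

lemma mollify_mem {G ρ : ℝ × ℝ → ℂ} (hG : LocallyIntegrable G) (hGc : HasCompactSupport G)
    (hρ : ρ ∈ testFunctions) : mollify G ρ ∈ testFunctions := by
  rw [mollify_eq_convolution]
  exact ⟨hρ.2.contDiff_convolution_right _ hG hρ.1, hGc.convolution _ hρ.2⟩

lemma pderiv_mollify {G ρ : ℝ × ℝ → ℂ} (hG : LocallyIntegrable G)
    (hρ : ρ ∈ testFunctions) (v p : ℝ × ℝ) :
    pderiv v (mollify G ρ) p = mollify G (pderiv v ρ) p := by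
  have h1 := hρ.2.hasFDerivAt_convolution_right (ContinuousLinearMap.mul ℝ ℂ) hG
    (hρ.1.of_le (by simp)) p
  rw [pderiv, mollify_eq_convolution, h1.fderiv,
    convolution_precompR_apply _ hG (hρ.2.fderiv ℝ) (hρ.1.continuous_fderiv (by simp))]
  rfl

lemma testFunctions.integrable_mul' {φ F : ℝ × ℝ → ℂ} (hφ : φ ∈ testFunctions)
    (hF : MemLp F 2) : Integrable (fun p => F p * φ p) :=
  hF.integrable_mul (testFunctions.memLp hφ volume)

lemma testFunctions.memLp_mul {m F : ℝ × ℝ → ℂ} (hm : m ∈ testFunctions)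
    (hF : MemLp F 2) : MemLp (fun p => m p * F p) 2 :=
  hF.mul (hm.1.continuous.memLp_top_of_hasCompactSupport hm.2 volume)

/-- `F'` acts as the derivative of `F` in the direction `v` on the test function `φ`. -/
def Green (v : ℝ × ℝ) (F F' φ : ℝ × ℝ → ℂ) : Prop :=
  ∫ p, F p * pderiv v φ p = -∫ p, F' p * φ p

/-- Derivatives of mollifications of `m F`: it suffices that `F'` is the derivative of `F` when
tested against `m` times a reflected translate of the mollifier. -/
lemma pderiv_mollify_mul {F F' m ρ : ℝ × ℝ → ℂ} (hF : MemLp F 2) (hF' : MemLp F' 2)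
    (hm : m ∈ testFunctions) (hρ : ρ ∈ testFunctions) (v p : ℝ × ℝ)
    (h : Green v F F' (fun q => m q * ρ (p - q))) :
    pderiv v (mollify (fun q => m q * F q) ρ) p
      = mollify (fun q => m q * F' q + pderiv v m q * F q) ρ p := by
  have hρp := testFunctions.comp_const_sub hρ p
  have hmF := testFunctions.memLp_mul hm hF
  rw [pderiv_mollify (hmF.locallyIntegrable (by norm_num)) hρ]
  have hprod := testFunctions.mul hm hρp.1
  have hdm := testFunctions.pderiv_mem hm v
  -- The derivative on the kernel is moved onto the whole product `m ρ(p - ·)`, the function against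
  -- which the weak derivative is tested; the correction term carries the derivative of `m`.
  have e1 : ∀ q, m q * F q * pderiv v ρ (p - q)
      = pderiv v m q * F q * ρ (p - q) - F q * pderiv v (fun q => m q * ρ (p - q)) q := by
    intro q
    rw [pderiv_mul (testFunctions.differentiable hm) (testFunctions.differentiable hρp),
      pderiv_comp_const_sub (testFunctions.differentiable hρ)]
    ring
  have i1 : Integrable fun q => pderiv v m q * F q * ρ (p - q) :=
    testFunctions.integrable_mul' hρp (testFunctions.memLp_mul hdm hF)
  have i2 : Integrable fun q => m q * F' q * ρ (p - q) :=
    testFunctions.integrable_mul' hρp (testFunctions.memLp_mul hm hF')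
  have i3 : Integrable fun q => F q * pderiv v (fun q => m q * ρ (p - q)) q :=
    testFunctions.integrable_mul' (testFunctions.pderiv_mem hprod v) hF
  simp only [mollify]
  simp_rw [e1, add_mul]
  rw [integral_sub i1 i3, integral_add i2 i1, h]
  have : ∫ q, F' q * (m q * ρ (p - q)) = ∫ q, m q * F' q * ρ (p - q) := by
    congr 1; funext q; ring
  rw [this]; ring

/-! ### Cutoffs and the pairing -/

/-- A test function together with its two partial derivatives. -/
def jet (ψ : ℝ × ℝ → ℂ) : Fin 3 → ℝ × ℝ → ℂ := ![ψ, pderiv dirX ψ, pderiv dirY ψ]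

/-- The product rule applied to the product of a smooth function `m` with a function `U 0`
whose partial derivatives are `U 1` and `U 2`. -/
def cutoff (U : Fin 3 → ℝ × ℝ → ℂ) (m : ℝ × ℝ → ℂ) : Fin 3 → ℝ × ℝ → ℂ :=
  ![fun q => m q * U 0 q, fun q => m q * U 1 q + pderiv dirX m q * U 0 q,
    fun q => m q * U 2 q + pderiv dirY m q * U 0 q]

lemma memLp_cutoff {U : Fin 3 → ℝ × ℝ → ℂ} (hU : ∀ i, MemLp (U i) 2) {m : ℝ × ℝ → ℂ}
    (hm : m ∈ testFunctions) (i : Fin 3) : MemLp (cutoff U m i) 2 := by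
  fin_cases i
  · exact testFunctions.memLp_mul hm (hU 0)
  · exact (testFunctions.memLp_mul hm (hU 1)).add
      (testFunctions.memLp_mul (testFunctions.pderiv_mem hm _) (hU 0))
  · exact (testFunctions.memLp_mul hm (hU 2)).add
      (testFunctions.memLp_mul (testFunctions.pderiv_mem hm _) (hU 0))

lemma pderiv_add {m m' : ℝ × ℝ → ℂ} (hm : Differentiable ℝ m) (hm' : Differentiable ℝ m')
    (v p : ℝ × ℝ) : pderiv v (fun q => m q + m' q) p = pderiv v m p + pderiv v m' p := by
  simp only [pderiv]
  rw [fderiv_fun_add (hm p) (hm' p)]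
  rfl

lemma cutoff_add (U : Fin 3 → ℝ × ℝ → ℂ) {m m' : ℝ × ℝ → ℂ} (hm : Differentiable ℝ m)
    (hm' : Differentiable ℝ m') (i : Fin 3) (q : ℝ × ℝ) :
    cutoff U (fun q => m q + m' q) i q = cutoff U m i q + cutoff U m' i q := by
  fin_cases i
  · simp [cutoff, add_mul]
  · simp only [cutoff, Fin.mk_one, Matrix.cons_val_one, Matrix.cons_val_zero]
    rw [pderiv_add hm hm']; ring
  · simp only [cutoff, Fin.reduceFinMk, Matrix.cons_val]
    rw [pderiv_add hm hm']; ring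

/-- The pairing of `W` with the translate by `q` of `m U`. -/
def pairing (W U : Fin 3 → ℝ × ℝ → ℂ) (m : ℝ × ℝ → ℂ) (q : ℝ × ℝ) : ℂ :=
  ∑ i, correlation (W i) (cutoff U m i) q

section

variable {W U : Fin 3 → ℝ × ℝ → ℂ}

lemma continuous_pairing (hW : ∀ i, MemLp (W i) 2) (hU : ∀ i, MemLp (U i) 2) {m : ℝ × ℝ → ℂ}
    (hm : m ∈ testFunctions) : Continuous (pairing W U m) :=
  continuous_finsetSum _ fun i _ => continuous_correlation (hW i) (memLp_cutoff hU hm i)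

/-- Additivity in the cutoff lets different pieces be treated with kernels of different supports, as
long as the same `q` lies in the closure of each. -/
lemma pairing_add (hW : ∀ i, MemLp (W i) 2) (hU : ∀ i, MemLp (U i) 2) {m m' : ℝ × ℝ → ℂ}
    (hm : m ∈ testFunctions) (hm' : m' ∈ testFunctions) (q : ℝ × ℝ) :
    pairing W U (fun q => m q + m' q) q = pairing W U m q + pairing W U m' q := by
  simp only [pairing, ← Finset.sum_add_distrib]
  refine Finset.sum_congr rfl fun i _ => ?_
  simp only [correlation]
  rw [← integral_add]
  · refine integral_congr_ae (ae_of_all _ fun p => ?_)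
    simp only
    rw [cutoff_add U (testFunctions.differentiable hm) (testFunctions.differentiable hm'), mul_add]
  · exact (hW i).integrable_mul (memLp_two_comp_sub (memLp_cutoff hU hm i) q)
  · exact (hW i).integrable_mul (memLp_two_comp_sub (memLp_cutoff hU hm' i) q)

/-- If `W` annihilates the space `N` of test functions, then it annihilates the translates of
`m U` by the vectors of `S`, provided that mollifications with kernels supported in `S` belong to
`N` and differentiate correctly on `Ω`. -/
lemma pairing_eq_zero (hW : ∀ i, MemLp (W i) 2) (hU : ∀ i, MemLp (U i) 2) {Ω : Set (ℝ × ℝ)}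
    (hWΩ : ∀ i, ∀ p ∉ Ω, W i p = 0) {N : Set (ℝ × ℝ → ℂ)}
    (hN : ∀ ψ ∈ testFunctions, ψ ∈ N → ∑ i, ∫ p, W i p * jet ψ i p = 0)
    {m : ℝ × ℝ → ℂ} (hm : m ∈ testFunctions) {S : Set (ℝ × ℝ)} (hS : IsOpen S)
    (hX : ∀ ρ ∈ testFunctions, tsupport ρ ⊆ S → ∀ p ∈ Ω,
      Green dirX (U 0) (U 1) fun q => m q * ρ (p - q))
    (hY : ∀ ρ ∈ testFunctions, tsupport ρ ⊆ S → ∀ p ∈ Ω,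
      Green dirY (U 0) (U 2) fun q => m q * ρ (p - q))
    (hD : ∀ ρ ∈ testFunctions, tsupport ρ ⊆ S → mollify (fun q => m q * U 0 q) ρ ∈ N) :
    ∀ q ∈ closure S, pairing W U m q = 0 := by
  refine eq_zero_on_closure_of_forall_integral (continuous_pairing hW hU hm) hS
    fun ρ hρ hρS => ?_
  have hψ : mollify (fun q => m q * U 0 q) ρ ∈ testFunctions :=
    mollify_mem ((testFunctions.memLp_mul hm (hU 0)).locallyIntegrable (by norm_num))
      hm.2.mul_right hρ
  have e : ∀ i, ∫ p, W i p * jet (mollify (fun q => m q * U 0 q) ρ) i p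
      = ∫ q, ρ q * correlation (W i) (cutoff U m i) q := by
    intro i
    rw [← integral_mul_convolution (hW i) (memLp_cutoff hU hm i) hρ]
    refine integral_congr_ae (ae_of_all _ fun p => ?_)
    -- Only points of `Ω` matter, because `W` vanishes elsewhere; the mollification may have
    -- unrelated derivatives outside.
    by_cases hp : p ∈ Ω
    · refine congrArg (W i p * ·) ?_
      fin_cases i
      · rfl
      · exact pderiv_mollify_mul (hU 0) (hU 1) hm hρ dirX p (hX ρ hρ hρS p hp)
      · exact pderiv_mollify_mul (hU 0) (hU 2) hm hρ dirY p (hY ρ hρ hρS p hp)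
    · simp [hWΩ i p hp]
  have h0 := hN _ hψ (hD ρ hρ hρS)
  simp only [pairing, Finset.mul_sum]
  rw [integral_finsetSum]
  · rw [← h0]
    exact Finset.sum_congr rfl fun i _ => (e i).symm
  · intro i _
    refine Continuous.integrable_of_hasCompactSupport ?_ hρ.2.mul_right
    exact hρ.1.continuous.mul (continuous_correlation (hW i) (memLp_cutoff hU hm i))

lemma pderiv_comp_smul {θ : ℝ × ℝ → ℂ} (hθ : Differentiable ℝ θ) (v p : ℝ × ℝ) (c : ℝ) :
    pderiv v (fun q => θ (c • q)) p = c * pderiv v θ (c • p) := by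
  simp only [pderiv]
  have h : HasFDerivAt (fun q : ℝ × ℝ => c • q) (c • ContinuousLinearMap.id ℝ (ℝ × ℝ)) p :=
    (hasFDerivAt_id p).const_smul c
  have h' : HasFDerivAt (fun q => θ (c • q)) _ p := (hθ (c • p)).hasFDerivAt.comp p h
  rw [h'.fderiv]
  simp

lemma exists_testFunction_eq_one_at_zero : ∃ θ ∈ testFunctions, θ 0 = 1 := by
  let b : ContDiffBump (0 : ℝ × ℝ) := ⟨1, 2, by norm_num, by norm_num⟩
  refine ⟨fun x => (b x : ℂ), ⟨Complex.ofRealCLM.contDiff.comp b.contDiff,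
    b.hasCompactSupport.comp_left (g := ((↑) : ℝ → ℂ)) (by simp)⟩, ?_⟩
  have : b 0 = 1 := b.one_of_mem_closedBall (Metric.mem_closedBall_self b.rIn_pos.le)
  simp [this]

lemma testFunctions.exists_bound {θ : ℝ × ℝ → ℂ} (hθ : θ ∈ testFunctions) :
    ∃ C, ∀ p, ‖θ p‖ ≤ C := hθ.2.exists_bound_of_continuous hθ.1.continuous

/-- Truncation by dilated test functions: it suffices to know the pairing with the truncated
functions. -/
lemma sum_integral_eq_zero_of_pairing (hW : ∀ i, MemLp (W i) 2) (hU : ∀ i, MemLp (U i) 2)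
    (h : ∀ θ ∈ testFunctions, pairing W U θ 0 = 0) : ∑ i, ∫ p, W i p * U i p = 0 := by
  obtain ⟨θ, hθ, hθ0⟩ := exists_testFunction_eq_one_at_zero
  -- The dilates `θ(c n • p)` tend to `θ 0 = 1` pointwise. Their derivatives carry a factor `c n`,
  -- hence tend to zero, and `c n ≤ 1` keeps them uniformly bounded for dominated convergence.
  let c : ℕ → ℝ := fun n => 1 / ((n : ℝ) + 1)
  have hc0 : Tendsto c atTop (𝓝 0) := tendsto_one_div_add_atTop_nhds_zero_nat
  have hcpos : ∀ n, 0 < c n := fun n => by positivity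
  have hc1 : ∀ n, c n ≤ 1 := fun n => by
    simp only [c]; rw [div_le_one (by positivity)]; linarith [n.cast_nonneg (α := ℝ)]
  have hmem : ∀ n, (fun p => θ (c n • p)) ∈ testFunctions := fun n =>
    ⟨hθ.1.comp (contDiff_const_smul _), hθ.2.comp_smul (hcpos n).ne'⟩
  obtain ⟨C, hC⟩ := testFunctions.exists_bound hθ
  have hlim : ∀ {χ : ℝ × ℝ → ℂ}, χ ∈ testFunctions → ∀ p, Tendsto (fun n => χ (c n • p)) atTop
      (𝓝 (χ 0)) := by
    intro χ hχ p
    have : Tendsto (fun n => c n • p) atTop (𝓝 0) := by simpa using hc0.smul_const p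
    exact (hχ.1.continuous.tendsto 0).comp this
  have hcC : Tendsto (fun n => (c n : ℂ)) atTop (𝓝 0) := by
    simpa [Function.comp_def] using (Complex.continuous_ofReal.tendsto 0).comp hc0
  have hdlim : ∀ v p, Tendsto (fun n => pderiv v (fun q => θ (c n • q)) p) atTop (𝓝 0) := by
    intro v p
    simp_rw [pderiv_comp_smul (testFunctions.differentiable hθ)]
    simpa using hcC.mul (hlim (testFunctions.pderiv_mem hθ v) p)
  have hdb : ∀ v, ∃ C, ∀ n p, ‖pderiv v (fun q => θ (c n • q)) p‖ ≤ C := by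
    intro v
    obtain ⟨C', hC'⟩ := testFunctions.exists_bound (testFunctions.pderiv_mem hθ v)
    refine ⟨C', fun n p => ?_⟩
    rw [pderiv_comp_smul (testFunctions.differentiable hθ), norm_mul, Complex.norm_real,
      Real.norm_of_nonneg (hcpos n).le]
    exact (mul_le_of_le_one_left (norm_nonneg _) (hc1 n)).trans (hC' _)
  have key : ∀ {f f' : ℝ × ℝ → ℂ} {a b : ℕ → ℝ × ℝ → ℂ} {A B : ℝ},
      Integrable f → Integrable f' → (∀ n, Continuous (a n)) → (∀ n, Continuous (b n)) →
      (∀ n p, ‖a n p‖ ≤ A) → (∀ n p, ‖b n p‖ ≤ B) → (∀ p, Tendsto (a · p) atTop (𝓝 1)) →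
      (∀ p, Tendsto (b · p) atTop (𝓝 0)) →
      Tendsto (fun n => ∫ p, (a n p * f p + b n p * f' p)) atTop (𝓝 (∫ p, f p)) := by
    intro f f' a b A B hf hf' ha hb hA hB hal hbl
    refine tendsto_integral_of_dominated_convergence (fun p => A * ‖f p‖ + B * ‖f' p‖)
      (fun n => ?_) ((hf.norm.const_mul A).add (hf'.norm.const_mul B)) (fun n => ?_) ?_
    · exact ((ha n).aestronglyMeasurable.mul hf.1).add ((hb n).aestronglyMeasurable.mul hf'.1)
    · refine ae_of_all _ fun p => (norm_add_le _ _).trans ?_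
      rw [norm_mul, norm_mul]
      gcongr
      exacts [hA n p, hB n p]
    · refine ae_of_all _ fun p => ?_
      simpa using ((hal p).mul_const (f p)).add ((hbl p).mul_const (f' p))
  have hθl : ∀ p, Tendsto (fun n => θ (c n • p)) atTop (𝓝 1) := fun p => hθ0 ▸ hlim hθ p
  have hi : ∀ i j, Integrable (fun p => W i p * U j p) := fun i j => (hW i).integrable_mul (hU j)
  have hcd : ∀ v n, Continuous (pderiv v (fun q => θ (c n • q))) := fun v n =>
    (testFunctions.pderiv_mem (hmem n) v).1.continuous
  have hterm : ∀ i, Tendsto (fun n => correlation (W i) (cutoff U (fun p => θ (c n • p)) i) 0)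
      atTop (𝓝 (∫ p, W i p * U i p)) := by
    intro i
    obtain ⟨CX, hCX⟩ := hdb dirX
    obtain ⟨CY, hCY⟩ := hdb dirY
    simp only [correlation, sub_zero]
    fin_cases i
    · refine (key (b := fun _ _ => 0) (B := 0) (hi 0 0) (hi 0 0)
        (fun n => (hmem n).1.continuous) (fun _ => continuous_const) (fun n p => hC _)
        (fun _ _ => by simp) hθl (fun _ => tendsto_const_nhds)).congr fun n => ?_
      refine integral_congr_ae (ae_of_all _ fun p => ?_)
      simp only [cutoff, Fin.zero_eta, Matrix.cons_val_zero]
      ring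
    · refine (key (hi 1 1) (hi 1 0) (fun n => (hmem n).1.continuous) (hcd dirX)
        (fun n p => hC _) hCX hθl (hdlim dirX)).congr fun n => ?_
      refine integral_congr_ae (ae_of_all _ fun p => ?_)
      simp only [cutoff, Fin.mk_one, Matrix.cons_val_one, Matrix.cons_val_zero]
      ring
    · refine (key (hi 2 2) (hi 2 0) (fun n => (hmem n).1.continuous) (hcd dirY)
        (fun n p => hC _) hCY hθl (hdlim dirY)).congr fun n => ?_
      refine integral_congr_ae (ae_of_all _ fun p => ?_)
      simp only [cutoff, Fin.reduceFinMk, Matrix.cons_val]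
      ring
  have hsum := tendsto_finsetSum Finset.univ fun i _ => hterm i
  refine tendsto_nhds_unique hsum (Tendsto.congr (fun n => ?_) tendsto_const_nhds)
  exact (h _ (hmem n)).symm

end

/-! ### Duality in the Sobolev space -/

/-- The extension by zero of an element of `L²(Ω)` to the plane. -/
def zeroExt {Ω : Set (ℝ × ℝ)} (f : Lp ℂ 2 (volume.restrict Ω)) : ℝ × ℝ → ℂ := Ω.indicator f

lemma memLp_zeroExt {Ω : Set (ℝ × ℝ)} (hΩ : MeasurableSet Ω)
    (f : Lp ℂ 2 (volume.restrict Ω)) : MemLp (zeroExt f) 2 :=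
  (memLp_indicator_iff_restrict hΩ).2 (Lp.memLp f)

lemma integral_zeroExt_mul {Ω : Set (ℝ × ℝ)} (hΩ : MeasurableSet Ω)
    (f : Lp ℂ 2 (volume.restrict Ω)) (φ : ℝ × ℝ → ℂ) :
    ∫ p, zeroExt f p * φ p = ∫ p in Ω, f p * φ p := by
  rw [← integral_indicator hΩ]
  congr 1
  funext p
  by_cases hp : p ∈ Ω <;> simp [zeroExt, hp]

lemma IsWeakDeriv.green {Ω : Set (ℝ × ℝ)} (hΩ : MeasurableSet Ω) {v : ℝ × ℝ}
    {f g : Lp ℂ 2 (volume.restrict Ω)} (h : IsWeakDeriv Ω v f g) {φ : ℝ × ℝ → ℂ}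
    (hφ : φ ∈ testFunctions) (hs : tsupport φ ⊆ Ω) : Green v (zeroExt f) (zeroExt g) φ := by
  rw [Green, integral_zeroExt_mul hΩ, integral_zeroExt_mul hΩ]
  exact h φ hφ hs

/-- A closedness criterion by duality: `f` belongs to the closure of the image of `N` in `H¹(Ω)`
if it is annihilated by everything that annihilates `N`. -/
lemma mem_closure_of_forall_annihilator {Ω : Set (ℝ × ℝ)} (hΩ : MeasurableSet Ω)
    (N : Submodule ℂ testFunctions) (f : H1 Ω)
    (h : ∀ W : Fin 3 → ℝ × ℝ → ℂ, (∀ i, MemLp (W i) 2) → (∀ i, ∀ p ∉ Ω, W i p = 0) →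
      (∀ ψ ∈ N, ∑ i, ∫ p, W i p * jet ψ i p = 0) →
      ∑ i, ∫ p, W i p * zeroExt (f.1 i) p = 0) :
    f ∈ closure (toH1 Ω '' (N : Set testFunctions)) := by
  rw [closure_subtype]
  let K : Submodule ℂ (PiLp 2 (fun _ : Fin 3 => Lp ℂ 2 (volume.restrict Ω))) :=
    (N.map (toH1 Ω)).map (H1 Ω).subtype
  have hK : (K : Set (PiLp 2 (fun _ : Fin 3 => Lp ℂ 2 (volume.restrict Ω)))) =
      ((↑) : H1 Ω → PiLp 2 (fun _ : Fin 3 => Lp ℂ 2 (volume.restrict Ω))) '' (toH1 Ω '' (N : Set testFunctions)) := by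
    simp [K]
  rw [← hK, ← Submodule.topologicalClosure_coe, SetLike.mem_coe,
    ← Submodule.orthogonal_orthogonal_eq_closure, Submodule.mem_orthogonal]
  intro w hw
  -- The inner product is conjugate-linear in `w`, so the triple tested bilinearly is the conjugate
  -- of the zero extension of `w`.
  have hinner : ∀ u : PiLp 2 (fun _ : Fin 3 => Lp ℂ 2 (volume.restrict Ω)),
      inner ℂ w u = ∑ i, ∫ p, (starRingEnd ℂ) (zeroExt (w i) p) * zeroExt (u i) p := by
    intro u
    rw [PiLp.inner_apply]
    refine Finset.sum_congr rfl fun i _ => ?_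
    rw [L2.inner_def, ← integral_indicator hΩ]
    congr 1
    funext p
    by_cases hp : p ∈ Ω <;> simp [zeroExt, hp, mul_comm]
  rw [hinner]
  refine h (fun i p => (starRingEnd ℂ) (zeroExt (w i) p)) (fun i => (memLp_zeroExt hΩ (w i)).star)
    (fun i p hp => by simp [zeroExt, hp]) fun ψ hψ => ?_
  have h0 : inner ℂ w ((toH1 Ω ψ : H1 Ω) : PiLp 2 _) = 0 := by
    have h1 : inner ℂ ((toH1 Ω ψ : H1 Ω) : PiLp 2 _) w = 0 :=
      (Submodule.mem_orthogonal _ _).1 hw _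
        (Submodule.mem_map_of_mem (f := (H1 Ω).subtype) (Submodule.mem_map_of_mem hψ))
    rw [← inner_conj_symm, h1, map_zero]
  rw [← h0, hinner]
  refine Finset.sum_congr rfl fun i _ => ?_
  have hL : ∀ χ : testFunctions, ∫ p, (starRingEnd ℂ) (zeroExt (w i) p) * χ.1 p
      = ∫ p, (starRingEnd ℂ) (zeroExt (w i) p) * zeroExt (toL2 (volume.restrict Ω) χ) p := by
    intro χ
    refine integral_congr_ae ?_
    filter_upwards [(ae_restrict_iff' hΩ).1
      (testFunctions.memLp χ.2 (volume.restrict Ω)).coeFn_toLp] with p hp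
    by_cases hpΩ : p ∈ Ω
    · have : (toL2 (volume.restrict Ω) χ : ℝ × ℝ → ℂ) p = χ.1 p := hp hpΩ
      simp [zeroExt, hpΩ, this]
    · simp [zeroExt, hpΩ]
  fin_cases i
  · exact hL ψ
  · exact hL ⟨pderiv dirX ψ, testFunctions.pderiv_mem ψ.2 dirX⟩
  · exact hL ⟨pderiv dirY ψ, testFunctions.pderiv_mem ψ.2 dirY⟩

/-! ### One-sided mollification and density of smooth functions in the strip -/

lemma isOpen_strip (d : ℝ) : IsOpen (strip d) := isOpen_univ.prod isOpen_Ioo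

lemma measurableSet_strip (d : ℝ) : MeasurableSet (strip d) := (isOpen_strip d).measurableSet

lemma mem_strip {d : ℝ} {p : ℝ × ℝ} : p ∈ strip d ↔ 0 < p.2 ∧ p.2 < d := by simp [strip]

lemma exists_smoothStep {a b : ℝ} (hab : a < b) :
    ∃ s : ℝ → ℂ, ContDiff ℝ ∞ s ∧ (∀ x ≤ a, s x = 0) ∧ ∀ x ≥ b, s x = 1 := by
  refine ⟨fun x => (Real.smoothTransition ((x - a) / (b - a)) : ℂ),
    Complex.ofRealCLM.contDiff.comp (Real.smoothTransition.contDiff.comp (by fun_prop)),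
    fun x hx => ?_, fun x hx => ?_⟩
  · dsimp only
    rw [Real.smoothTransition.zero_of_nonpos, Complex.ofReal_zero]
    exact div_nonpos_of_nonpos_of_nonneg (by linarith) (by linarith)
  · dsimp only
    rw [Real.smoothTransition.one_of_one_le, Complex.ofReal_one]
    rw [le_div_iff₀ (by linarith)]
    linarith

lemma tsupport_mul_comp_const_sub (m ρ : ℝ × ℝ → ℂ) (p : ℝ × ℝ) {x : ℝ × ℝ}
    (hx : x ∈ tsupport fun q => m q * ρ (p - q)) : x ∈ tsupport m ∧ p - x ∈ tsupport ρ := by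
  refine ⟨closure_mono (fun q hq => left_ne_zero_of_mul hq) hx, ?_⟩
  have hc : IsClosed {q : ℝ × ℝ | p - q ∈ tsupport ρ} :=
    (isClosed_tsupport ρ).preimage (by fun_prop : Continuous fun q : ℝ × ℝ => p - q)
  have hsub : Function.support (fun q => m q * ρ (p - q)) ⊆ {q : ℝ × ℝ | p - q ∈ tsupport ρ} :=
    fun q hq => subset_closure (right_ne_zero_of_mul hq)
  exact closure_minimal hsub hc hx

/-- A mollification at `p` vanishes if the mollified function vanishes on `p - S`. -/
lemma mollify_eq_zero {G ρ : ℝ × ℝ → ℂ} {S : Set (ℝ × ℝ)} (hρ : tsupport ρ ⊆ S) {p : ℝ × ℝ}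
    (h : ∀ q, p - q ∈ S → G q = 0) : mollify G ρ p = 0 := by
  rw [mollify, ← integral_zero (ℝ × ℝ) ℂ]
  refine integral_congr_ae (ae_of_all _ fun q => ?_)
  by_cases hq : p - q ∈ tsupport ρ
  · simp [h q (hρ hq)]
  · simp [image_eq_zero_of_notMem_tsupport hq]

section

variable {d : ℝ} {W : Fin 3 → ℝ × ℝ → ℂ} {N : Set (ℝ × ℝ → ℂ)} {m : ℝ × ℝ → ℂ}
  {S : Set (ℝ × ℝ)}

/-- Approximation away from the upper edge by kernels that sample from above. -/
lemma pairing_eq_zero_of_below (hW : ∀ i, MemLp (W i) 2)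
    (hWΩ : ∀ i, ∀ p ∉ strip d, W i p = 0)
    (hN : ∀ ψ ∈ testFunctions, ψ ∈ N → ∑ i, ∫ p, W i p * jet ψ i p = 0)
    (f : H1 (strip d)) (hm : m ∈ testFunctions) (hmd : ∀ p ∈ tsupport m, p.2 < d)
    (hS : IsOpen S) (hS0 : ∀ q ∈ S, q.2 < 0)
    (hD : ∀ ρ ∈ testFunctions, tsupport ρ ⊆ S → mollify (fun q => m q * zeroExt (f.1 0) q) ρ ∈ N) :
    ∀ q ∈ closure S, pairing W (fun i => zeroExt (f.1 i)) m q = 0 := by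
  -- A sampled point `x` has `p - x ∈ S`, so it lies above `p` and hence above the lower edge; the
  -- cutoff keeps it below the upper one.
  have hs : ∀ ρ ∈ testFunctions, tsupport ρ ⊆ S → ∀ p ∈ strip d,
      tsupport (fun q => m q * ρ (p - q)) ⊆ strip d := by
    intro ρ _ hρS p hp x hx
    obtain ⟨h1, h2⟩ := tsupport_mul_comp_const_sub m ρ p hx
    have h3 := hS0 _ (hρS h2)
    rw [mem_strip] at hp ⊢
    rw [Prod.snd_sub] at h3
    exact ⟨by linarith, hmd x h1⟩
  refine pairing_eq_zero hW (fun i => memLp_zeroExt (measurableSet_strip d) _) hWΩ hN hm hS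
    (fun ρ hρ hρS p hp => ?_) (fun ρ hρ hρS p hp => ?_) hD
  · exact f.2.1.green (measurableSet_strip d)
      (testFunctions.mul hm (testFunctions.comp_const_sub hρ p).1) (hs ρ hρ hρS p hp)
  · exact f.2.2.green (measurableSet_strip d)
      (testFunctions.mul hm (testFunctions.comp_const_sub hρ p).1) (hs ρ hρ hρS p hp)

/-- Approximation away from the lower edge by kernels that sample from below. -/
lemma pairing_eq_zero_of_above (hW : ∀ i, MemLp (W i) 2)
    (hWΩ : ∀ i, ∀ p ∉ strip d, W i p = 0)
    (hN : ∀ ψ ∈ testFunctions, ψ ∈ N → ∑ i, ∫ p, W i p * jet ψ i p = 0)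
    (f : H1 (strip d)) (hm : m ∈ testFunctions) (hmd : ∀ p ∈ tsupport m, 0 < p.2)
    (hS : IsOpen S) (hS0 : ∀ q ∈ S, 0 < q.2)
    (hD : ∀ ρ ∈ testFunctions, tsupport ρ ⊆ S → mollify (fun q => m q * zeroExt (f.1 0) q) ρ ∈ N) :
    ∀ q ∈ closure S, pairing W (fun i => zeroExt (f.1 i)) m q = 0 := by
  have hs : ∀ ρ ∈ testFunctions, tsupport ρ ⊆ S → ∀ p ∈ strip d,
      tsupport (fun q => m q * ρ (p - q)) ⊆ strip d := by
    intro ρ _ hρS p hp x hx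
    obtain ⟨h1, h2⟩ := tsupport_mul_comp_const_sub m ρ p hx
    have h3 := hS0 _ (hρS h2)
    rw [mem_strip] at hp ⊢
    rw [Prod.snd_sub] at h3
    exact ⟨hmd x h1, by linarith⟩
  refine pairing_eq_zero hW (fun i => memLp_zeroExt (measurableSet_strip d) _) hWΩ hN hm hS
    (fun ρ hρ hρS p hp => ?_) (fun ρ hρ hρS p hp => ?_) hD
  · exact f.2.1.green (measurableSet_strip d)
      (testFunctions.mul hm (testFunctions.comp_const_sub hρ p).1) (hs ρ hρ hρS p hp)
  · exact f.2.2.green (measurableSet_strip d)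
      (testFunctions.mul hm (testFunctions.comp_const_sub hρ p).1) (hs ρ hρ hρS p hp)

end

lemma tsupport_subset_of_forall {m : ℝ × ℝ → ℂ} {C : Set (ℝ × ℝ)} (hC : IsClosed C)
    (h : ∀ p ∉ C, m p = 0) : tsupport m ⊆ C :=
  closure_minimal (fun p hp => by_contra fun hpC => hp (h p hpC)) hC

/-- The splitting of a test function into a part away from the upper edge of the strip and a part
away from the lower edge. -/
lemma exists_split_vertical {d : ℝ} (hd : 0 < d) {θ : ℝ × ℝ → ℂ} (hθ : θ ∈ testFunctions) :
    ∃ m ∈ testFunctions, ∃ m' ∈ testFunctions, (∀ p, θ p = m p + m' p) ∧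
      (∀ p, 2 * d / 3 ≤ p.2 → m p = 0) ∧ (∀ p, p.2 ≤ d / 3 → m' p = 0) := by
  obtain ⟨s, hs, hs0, hs1⟩ := exists_smoothStep (show d / 3 < 2 * d / 3 by linarith)
  refine ⟨_, testFunctions.mul hθ (contDiff_const.sub (hs.comp contDiff_snd) :
    ContDiff ℝ ∞ fun p : ℝ × ℝ => 1 - s p.2), _, testFunctions.mul hθ (hs.comp contDiff_snd :
    ContDiff ℝ ∞ fun p : ℝ × ℝ => s p.2), fun p => by simp only [Function.comp]; ring, fun p hp => ?_, fun p hp => ?_⟩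
  · simp [hs1 p.2 hp]
  · simp [hs0 p.2 hp]

/-- The splitting of a test function by a vertical line. -/
lemma exists_split_horizontal {a b : ℝ} (hab : a < b) {θ : ℝ × ℝ → ℂ} (hθ : θ ∈ testFunctions) :
    ∃ m ∈ testFunctions, ∃ m' ∈ testFunctions, (∀ p, θ p = m p + m' p) ∧
      (∀ p, b ≤ p.1 → m p = 0) ∧ (∀ p, p.1 ≤ a → m' p = 0) ∧
      (∀ p, θ p = 0 → m p = 0 ∧ m' p = 0) := by
  obtain ⟨s, hs, hs0, hs1⟩ := exists_smoothStep hab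
  refine ⟨_, testFunctions.mul hθ (contDiff_const.sub (hs.comp contDiff_fst) :
    ContDiff ℝ ∞ fun p : ℝ × ℝ => 1 - s p.1), _, testFunctions.mul hθ (hs.comp contDiff_fst :
    ContDiff ℝ ∞ fun p : ℝ × ℝ => s p.1), fun p => by simp only [Function.comp]; ring, fun p hp => ?_, fun p hp => ?_,
    fun p hp => ?_⟩
  · simp [hs1 p.1 hp]
  · simp [hs0 p.1 hp]
  · simp [hp]

lemma snd_lt_of_mem_tsupport {d : ℝ} {m : ℝ × ℝ → ℂ} (hd : 0 < d) (h : ∀ p : ℝ × ℝ, 2 * d / 3 ≤ p.2 → m p = 0) :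
    ∀ p ∈ tsupport m, p.2 < d := by
  intro p hp
  have := tsupport_subset_of_forall (C := {p : ℝ × ℝ | p.2 ≤ 2 * d / 3})
    (isClosed_le continuous_snd continuous_const) (fun p hp => h p (not_le.1 hp).le) hp
  have : p.2 ≤ 2 * d / 3 := this
  linarith

lemma snd_pos_of_mem_tsupport {d : ℝ} {m : ℝ × ℝ → ℂ} (hd : 0 < d) (h : ∀ p : ℝ × ℝ, p.2 ≤ d / 3 → m p = 0) :
    ∀ p ∈ tsupport m, 0 < p.2 := by
  intro p hp
  have := tsupport_subset_of_forall (C := {p : ℝ × ℝ | d / 3 ≤ p.2})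
    (isClosed_le continuous_const continuous_snd) (fun p hp => h p (not_le.1 hp).le) hp
  have : d / 3 ≤ p.2 := this
  linarith

/-- With no boundary condition every mollification is admissible. Each half of a vertical splitting
stays away from one edge and is sampled towards that edge; the zero vector is in the closure of both
half-planes. -/
lemma denseRange_toH1_strip {d : ℝ} (hd : 0 < d) : DenseRange (toH1 (strip d)) := by
  intro f
  have := mem_closure_of_forall_annihilator (measurableSet_strip d) ⊤ f ?_
  · simpa using this
  intro W hW hWΩ hN
  have hN' : ∀ ψ ∈ testFunctions, ψ ∈ (univ : Set (ℝ × ℝ → ℂ)) →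
      ∑ i, ∫ p, W i p * jet ψ i p = 0 := fun ψ hψ _ => hN ⟨ψ, hψ⟩ trivial
  have hU : ∀ i, MemLp (zeroExt (f.1 i)) 2 := fun i => memLp_zeroExt (measurableSet_strip d) _
  refine sum_integral_eq_zero_of_pairing hW hU fun θ hθ => ?_
  obtain ⟨m, hm, m', hm', hadd, h0, h0'⟩ := exists_split_vertical hd hθ
  rw [funext hadd, pairing_add hW hU hm hm']
  have e1 := pairing_eq_zero_of_below hW hWΩ hN' f hm (snd_lt_of_mem_tsupport hd h0)
    (S := univ ×ˢ Iio 0) (isOpen_univ.prod isOpen_Iio) (fun q hq => hq.2) (fun _ _ _ => trivial) 0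
    (by rw [closure_prod_eq, closure_Iio]; simp)
  have e2 := pairing_eq_zero_of_above hW hWΩ hN' f hm' (snd_pos_of_mem_tsupport hd h0')
    (S := univ ×ˢ Ioi 0) (isOpen_univ.prod isOpen_Ioi) (fun q hq => hq.2) (fun _ _ _ => trivial) 0
    (by rw [closure_prod_eq, closure_Ioi]; simp)
  rw [e1, e2, add_zero]

/-! ### Divergence theorem, trace and Green's formula -/

lemma testFunctions.integrable {φ : ℝ × ℝ → ℂ} (hφ : φ ∈ testFunctions)
    (μ : Measure (ℝ × ℝ)) [IsFiniteMeasureOnCompacts μ] : Integrable φ μ :=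
  hφ.1.continuous.integrable_of_hasCompactSupport hφ.2

lemma integral_boundaryMeasure {d : ℝ} {g : ℝ × ℝ → ℂ} (hg : Integrable g (boundaryMeasure d)) :
    ∫ p, g p ∂(boundaryMeasure d) = ∫ x, (g (x, 0) + g (x, d)) := by
  unfold boundaryMeasure at hg ⊢
  rw [integral_prod _ hg]
  congr 1
  funext x
  rw [integral_add_measure (integrable_dirac (by simp)) (integrable_dirac (by simp)),
    integral_dirac, integral_dirac]

lemma ae_boundaryMeasure (d : ℝ) : ∀ᵐ p ∂(boundaryMeasure d), p.2 = 0 ∨ p.2 = d := by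
  have h : {p : ℝ × ℝ | ¬(p.2 = 0 ∨ p.2 = d)} = univ ×ˢ ({0, d} : Set ℝ)ᶜ := by
    ext p; simp
  rw [ae_iff, h, boundaryMeasure, Measure.prod_prod]
  simp

/-- The vertical component of the outer normal of the strip, extended to the plane. -/
def normal (d : ℝ) (p : ℝ × ℝ) : ℂ := ((2 / d * p.2 - 1 : ℝ) : ℂ)

lemma contDiff_normal (d : ℝ) : ContDiff ℝ ∞ (normal d) :=
  Complex.ofRealCLM.contDiff.comp ((contDiff_const.mul contDiff_snd).sub contDiff_const)

lemma normal_lower (d x : ℝ) : normal d (x, 0) = -1 := by simp [normal]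

lemma normal_upper {d : ℝ} (hd : 0 < d) (x : ℝ) : normal d (x, d) = 1 := by
  have : 2 / d * d - 1 = 1 := by field_simp; norm_num
  simp only [normal, this, Complex.ofReal_one]

lemma pderiv_normal (d : ℝ) (p : ℝ × ℝ) : pderiv dirY (normal d) p = ((2 / d : ℝ) : ℂ) := by
  have h1 : HasFDerivAt (fun p : ℝ × ℝ => 2 / d * p.2 - 1)
      ((2 / d) • ContinuousLinearMap.snd ℝ ℝ ℝ) p :=
    ((ContinuousLinearMap.snd ℝ ℝ ℝ).hasFDerivAt.const_mul (2 / d)).sub_const 1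
  have h2 : HasFDerivAt (normal d) (Complex.ofRealCLM.comp ((2 / d) • ContinuousLinearMap.snd ℝ ℝ ℝ))
      p := Complex.ofRealCLM.hasFDerivAt.comp p h1
  rw [pderiv, h2.fderiv]
  simp [dirY]

lemma norm_normal_le {d : ℝ} (hd : 0 < d) {p : ℝ × ℝ} (hp : p ∈ strip d) : ‖normal d p‖ ≤ 1 := by
  rw [mem_strip] at hp
  rw [normal, Complex.norm_real, Real.norm_eq_abs, abs_le]
  have h1 : 0 ≤ 2 / d * p.2 := by have := hp.1; positivity
  have h2 : 2 / d * p.2 ≤ 2 := by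
    rw [div_mul_eq_mul_div, div_le_iff₀ hd]
    linarith [hp.2]
  constructor <;> linarith

/-- The divergence theorem on the strip, vertical component. -/
lemma setIntegral_pderiv_dirY {d : ℝ} (hd : 0 < d) {h : ℝ × ℝ → ℂ} (hh : h ∈ testFunctions) :
    ∫ p in strip d, pderiv dirY h p = ∫ p, h p * normal d p ∂(boundaryMeasure d) := by
  have hn := testFunctions.mul hh (contDiff_normal d)
  rw [integral_boundaryMeasure (testFunctions.integrable hn _)]
  have hi : IntegrableOn (pderiv dirY h) (univ ×ˢ Ioo 0 d) :=
    (testFunctions.integrable (testFunctions.pderiv_mem hh dirY) volume).integrableOn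
  rw [strip, Measure.volume_eq_prod, setIntegral_prod _ hi, setIntegral_univ]
  congr 1
  funext x
  rw [← integral_Ioc_eq_integral_Ioo, ← intervalIntegral.integral_of_le hd.le,
    normal_lower, normal_upper hd]
  rw [intervalIntegral.integral_eq_sub_of_hasDerivAt (f := fun y => h (x, y))]
  · ring
  · intro y _
    have h1 : HasDerivAt (fun y : ℝ => (x, y)) ((0 : ℝ), (1 : ℝ)) y :=
      (hasDerivAt_const y x).prodMk (hasDerivAt_id y)
    exact (testFunctions.differentiable hh (x, y)).hasFDerivAt.comp_hasDerivAt y h1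
  · exact ((testFunctions.pderiv_mem hh dirY).1.continuous.comp
      (by fun_prop : Continuous fun y : ℝ => (x, y))).intervalIntegrable _ _

/-- The divergence theorem on the strip, horizontal component. -/
lemma setIntegral_pderiv_dirX {d : ℝ} {h : ℝ × ℝ → ℂ} (hh : h ∈ testFunctions) :
    ∫ p in strip d, pderiv dirX h p = 0 := by
  have hi : Integrable (pderiv dirX h) := testFunctions.integrable
    (testFunctions.pderiv_mem hh dirX) volume
  have hi' : Integrable (pderiv dirX h)
      (((volume : Measure ℝ).restrict univ).prod ((volume : Measure ℝ).restrict (Ioo 0 d))) := by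
    rw [Measure.prod_restrict]
    exact hi.integrableOn
  rw [strip, Measure.volume_eq_prod, ← Measure.prod_restrict, integral_prod_symm _ hi',
    Measure.restrict_univ, ← integral_zero ℝ ℂ (μ := (volume : Measure ℝ).restrict (Ioo 0 d))]
  congr 1
  funext y
  have he : Topology.IsClosedEmbedding fun x : ℝ => (x, y) := Function.LeftInverse.isClosedEmbedding
    (f := Prod.fst) (fun _ => rfl) continuous_fst (by fun_prop)
  have hc : HasCompactSupport fun x : ℝ => h (x, y) := hh.2.comp_isClosedEmbedding he
  have hd : ∀ x, HasDerivAt (fun x : ℝ => h (x, y)) (pderiv dirX h (x, y)) x := by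
    intro x
    have h1 : HasDerivAt (fun x : ℝ => (x, y)) ((1 : ℝ), (0 : ℝ)) x :=
      (hasDerivAt_id x).prodMk (hasDerivAt_const x y)
    exact (testFunctions.differentiable hh (x, y)).hasFDerivAt.comp_hasDerivAt x h1
  have hdc : HasCompactSupport fun x : ℝ => pderiv dirX h (x, y) :=
    (testFunctions.pderiv_mem hh dirX).2.comp_isClosedEmbedding he
  have hcont : Continuous fun x : ℝ => (x, y) := by fun_prop
  exact integral_eq_zero_of_hasDerivAt_of_integrable hd
    (((testFunctions.pderiv_mem hh dirX).1.continuous.comp hcont).integrable_of_hasCompactSupport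
      hdc)
    ((hh.1.continuous.comp hcont).integrable_of_hasCompactSupport hc)

lemma norm_toL2_sq (μ : Measure (ℝ × ℝ)) [IsFiniteMeasureOnCompacts μ] (ψ : testFunctions) :
    ‖toL2 μ ψ‖ ^ 2 = ∫ p, ‖ψ.1 p‖ ^ 2 ∂μ := by
  have h : ‖toL2 μ ψ‖ ^ 2 = RCLike.re (inner ℂ (toL2 μ ψ) (toL2 μ ψ)) :=
    (inner_self_eq_norm_sq (𝕜 := ℂ) _).symm
  rw [h, L2.inner_def, ← integral_re (L2.integrable_inner _ _)]
  refine integral_congr_ae ?_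
  filter_upwards [(testFunctions.memLp ψ.2 μ).coeFn_toLp] with p hp
  have : (toL2 μ ψ : ℝ × ℝ → ℂ) p = ψ.1 p := hp
  rw [this, inner_self_eq_norm_sq]

lemma norm_toH1_sq (Ω : Set (ℝ × ℝ)) (ψ : testFunctions) :
    ‖toH1 Ω ψ‖ ^ 2 = (∫ p in Ω, ‖ψ.1 p‖ ^ 2) + (∫ p in Ω, ‖pderiv dirX ψ p‖ ^ 2)
      + ∫ p in Ω, ‖pderiv dirY ψ p‖ ^ 2 := by
  rw [← norm_toL2_sq, ← norm_toL2_sq _ ⟨_, testFunctions.pderiv_mem ψ.2 dirX⟩,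
    ← norm_toL2_sq _ ⟨_, testFunctions.pderiv_mem ψ.2 dirY⟩, Submodule.coe_norm,
    PiLp.norm_sq_eq_of_L2, Fin.sum_univ_three]
  rfl

/-- Boundedness of the trace operator on smooth functions. -/
lemma norm_toL2_boundaryMeasure_le {d : ℝ} (hd : 0 < d) (ψ : testFunctions) :
    ‖toL2 (boundaryMeasure d) ψ‖ ≤ √(1 + 2 / d) * ‖toH1 (strip d) ψ‖ := by
  have hψ := ψ.2
  have hψd := testFunctions.differentiable ψ.2
  have hconj : ContDiff ℝ ∞ fun p => (starRingEnd ℂ) (ψ.1 p) :=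
    Complex.conjCLE.contDiff.comp hψ.1
  have hconjd : Differentiable ℝ fun p => (starRingEnd ℂ) (ψ.1 p) :=
    hconj.differentiable (by simp)
  have hsq := testFunctions.mul hψ hconj
  -- The divergence theorem is applied to `|ψ|² n`, with `n` the affine extension of the normal.
  -- Since `n² = 1` on both edges, the boundary integral is that of `|ψ|²`; the bound `|n| ≤ 1` and
  -- the slope `2 / d` yield the constant `1 + 2 / d`.
  have hh := testFunctions.mul hsq (contDiff_normal d)
  have hdiv := setIntegral_pderiv_dirY hd hh
  have hpc : ∀ p, pderiv dirY (fun p => (starRingEnd ℂ) (ψ.1 p)) p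
      = (starRingEnd ℂ) (pderiv dirY ψ.1 p) := by
    intro p
    have h1 : HasFDerivAt (fun p => (starRingEnd ℂ) (ψ.1 p)) _ p :=
      Complex.conjCLE.toContinuousLinearMap.hasFDerivAt.comp p (hψd p).hasFDerivAt
    rw [pderiv, h1.fderiv]
    simp [pderiv]
  have hbd : ∫ p, (ψ.1 p * (starRingEnd ℂ) (ψ.1 p) * normal d p) * normal d p ∂(boundaryMeasure d)
      = ((∫ p, ‖ψ.1 p‖ ^ 2 ∂(boundaryMeasure d) : ℝ) : ℂ) := by
    rw [← integral_complex_ofReal]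
    refine integral_congr_ae ?_
    filter_upwards [ae_boundaryMeasure d] with p hp
    have hn : normal d p * normal d p = 1 := by
      obtain ⟨x, y⟩ := p
      rcases hp with hp | hp
      · simp only at hp; rw [hp, normal_lower]; norm_num
      · simp only at hp; rw [hp, normal_upper hd]; norm_num
    rw [mul_assoc, hn, mul_one, Complex.mul_conj, Complex.normSq_eq_norm_sq]
  have i0 : Integrable (fun p => ‖ψ.1 p‖ ^ 2) (volume.restrict (strip d)) :=
    (testFunctions.memLp hψ _).norm.integrable_sq
  have i2 : Integrable (fun p => ‖pderiv dirY ψ.1 p‖ ^ 2) (volume.restrict (strip d)) :=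
    (testFunctions.memLp (testFunctions.pderiv_mem hψ dirY) _).norm.integrable_sq
  have hle : ∫ p, ‖ψ.1 p‖ ^ 2 ∂(boundaryMeasure d)
      ≤ (1 + 2 / d) * (∫ p in strip d, ‖ψ.1 p‖ ^ 2) + ∫ p in strip d, ‖pderiv dirY ψ.1 p‖ ^ 2 := by
    have h1 : ‖∫ p in strip d,
        pderiv dirY (fun p => ψ.1 p * (starRingEnd ℂ) (ψ.1 p) * normal d p) p‖
        ≤ ∫ p in strip d, ((1 + 2 / d) * ‖ψ.1 p‖ ^ 2 + ‖pderiv dirY ψ.1 p‖ ^ 2) := by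
      refine norm_integral_le_of_norm_le ((i0.const_mul _).add i2) ?_
      filter_upwards [ae_restrict_mem (measurableSet_strip d)] with p hp
      rw [pderiv_mul (testFunctions.differentiable hsq)
        ((contDiff_normal d).differentiable (by simp)), pderiv_mul hψd hconjd, hpc, pderiv_normal]
      have hn := norm_normal_le hd hp
      have hd' : ‖((2 / d : ℝ) : ℂ)‖ = 2 / d := by
        rw [Complex.norm_real, Real.norm_of_nonneg (by positivity)]
      calc _ ≤ ‖ψ.1 p‖ * ‖ψ.1 p‖ * (2 / d) + 1 * (‖ψ.1 p‖ * ‖pderiv dirY ψ.1 p‖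
            + ‖pderiv dirY ψ.1 p‖ * ‖ψ.1 p‖) := by
            refine (norm_add_le _ _).trans ?_
            rw [norm_mul, norm_mul, norm_mul, RCLike.norm_conj, hd', mul_comm _ ‖normal d p‖]
            gcongr
            refine (norm_add_le _ _).trans_eq ?_
            rw [norm_mul, norm_mul, RCLike.norm_conj, RCLike.norm_conj]
        _ ≤ _ := by nlinarith [sq_nonneg (‖ψ.1 p‖ - ‖pderiv dirY ψ.1 p‖)]
    rw [hdiv, hbd, integral_add (i0.const_mul _) i2, integral_const_mul] at h1
    refine le_trans ?_ h1
    rw [Complex.norm_real]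
    exact le_abs_self _
  have hX : 0 ≤ ∫ p in strip d, ‖pderiv dirX ψ.1 p‖ ^ 2 := integral_nonneg fun p => by positivity
  have hY : 0 ≤ ∫ p in strip d, ‖pderiv dirY ψ.1 p‖ ^ 2 := integral_nonneg fun p => by positivity
  refine le_of_sq_le_sq ?_ (by positivity)
  rw [mul_pow, Real.sq_sqrt (by positivity), norm_toL2_sq, norm_toH1_sq]
  refine hle.trans ?_
  have : 0 ≤ 2 / d := by positivity
  nlinarith [mul_nonneg this hX, mul_nonneg this hY]

/-- Density and boundedness are what identify the extension by continuity with restriction to the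
boundary on smooth functions. -/
lemma trace_toH1 {d : ℝ} (hd : 0 < d) (ψ : testFunctions) :
    trace d (toH1 (strip d) ψ) = toL2 (boundaryMeasure d) ψ :=
  LinearMap.extendOfNorm_eq (denseRange_toH1_strip hd) ⟨_, norm_toL2_boundaryMeasure_le hd⟩ ψ

lemma continuous_integral_mul {μ : Measure (ℝ × ℝ)} {g : ℝ × ℝ → ℂ} (hg : MemLp g 2 μ) :
    Continuous fun f : Lp ℂ 2 μ => ∫ p, f p * g p ∂μ := by
  have h : (fun f : Lp ℂ 2 μ => ∫ p, f p * g p ∂μ)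
      = fun f => inner ℂ (hg.star.toLp _) f := by
    funext f
    rw [L2.inner_def]
    refine integral_congr_ae ?_
    filter_upwards [hg.star.coeFn_toLp] with p hp
    rw [hp]
    simp
  rw [h]
  exact continuous_const.inner continuous_id

lemma continuous_H1_component (Ω : Set (ℝ × ℝ)) (i : Fin 3) :
    Continuous fun f : H1 Ω => f.1 i :=
  (PiLp.continuous_apply 2 _ i).comp continuous_subtype_val

lemma integral_toL2_mul (μ : Measure (ℝ × ℝ)) [IsFiniteMeasureOnCompacts μ] (ψ : testFunctions)
    (g : ℝ × ℝ → ℂ) : ∫ p, toL2 μ ψ p * g p ∂μ = ∫ p, ψ.1 p * g p ∂μ := by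
  refine integral_congr_ae ?_
  filter_upwards [(testFunctions.memLp ψ.2 μ).coeFn_toLp] with p hp
  have : (toL2 μ ψ : ℝ × ℝ → ℂ) p = ψ.1 p := hp
  rw [this]

/-- Integration by parts in `H¹` of the strip, vertical component. -/
lemma integral_mul_pderiv_dirY {d : ℝ} (hd : 0 < d) (f : H1 (strip d)) {φ : ℝ × ℝ → ℂ}
    (hφ : φ ∈ testFunctions) :
    (∫ p in strip d, f.1 0 p * pderiv dirY φ p) + ∫ p in strip d, f.1 2 p * φ p
      = ∫ p, trace d f p * (φ p * normal d p) ∂(boundaryMeasure d) := by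
  have hφ' := testFunctions.pderiv_mem hφ dirY
  have hφn := testFunctions.mul hφ (contDiff_normal d)
  -- Both sides are continuous in the `H¹` norm, so only smooth functions need checking.
  refine (denseRange_toH1_strip hd).induction_on f (isClosed_eq ?_ ?_) fun ψ => ?_
  · exact ((continuous_integral_mul (testFunctions.memLp hφ' _)).comp
      (continuous_H1_component _ 0)).add ((continuous_integral_mul
        (testFunctions.memLp hφ _)).comp (continuous_H1_component _ 2))
  · exact (continuous_integral_mul (testFunctions.memLp hφn _)).comp (trace d).continuous
  · rw [trace_toH1 hd, integral_toL2_mul]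
    have e := setIntegral_pderiv_dirY hd (testFunctions.mul ψ.2 hφ.1)
    have hi : ∀ {a b : ℝ × ℝ → ℂ}, a ∈ testFunctions → b ∈ testFunctions →
        Integrable (fun p => a p * b p) (volume.restrict (strip d)) := fun ha hb =>
      testFunctions.integrable (testFunctions.mul ha hb.1) _
    simp_rw [pderiv_mul (testFunctions.differentiable ψ.2) (testFunctions.differentiable hφ)] at e
    rw [integral_add (hi ψ.2 hφ') (hi (testFunctions.pderiv_mem ψ.2 dirY) hφ)] at e
    simp_rw [mul_assoc] at e
    rw [← e]
    exact congrArg₂ _ (integral_toL2_mul _ ψ _)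
      (integral_toL2_mul _ ⟨_, testFunctions.pderiv_mem ψ.2 dirY⟩ _)

/-- Integration by parts in `H¹` of the strip, horizontal component. -/
lemma integral_mul_pderiv_dirX {d : ℝ} (hd : 0 < d) (f : H1 (strip d)) {φ : ℝ × ℝ → ℂ}
    (hφ : φ ∈ testFunctions) :
    (∫ p in strip d, f.1 0 p * pderiv dirX φ p) + ∫ p in strip d, f.1 1 p * φ p = 0 := by
  have hφ' := testFunctions.pderiv_mem hφ dirX
  refine (denseRange_toH1_strip hd).induction_on f (isClosed_eq ?_ continuous_const) fun ψ => ?_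
  · exact ((continuous_integral_mul (testFunctions.memLp hφ' _)).comp
      (continuous_H1_component _ 0)).add ((continuous_integral_mul
        (testFunctions.memLp hφ _)).comp (continuous_H1_component _ 1))
  · have e := setIntegral_pderiv_dirX (d := d) (testFunctions.mul ψ.2 hφ.1)
    have hi : ∀ {a b : ℝ × ℝ → ℂ}, a ∈ testFunctions → b ∈ testFunctions →
        Integrable (fun p => a p * b p) (volume.restrict (strip d)) := fun ha hb =>
      testFunctions.integrable (testFunctions.mul ha hb.1) _
    simp_rw [pderiv_mul (testFunctions.differentiable ψ.2) (testFunctions.differentiable hφ)] at e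
    rw [integral_add (hi ψ.2 hφ') (hi (testFunctions.pderiv_mem ψ.2 dirX) hφ)] at e
    rw [← e]
    exact congrArg₂ _ (integral_toL2_mul _ ψ _)
      (integral_toL2_mul _ ⟨_, testFunctions.pderiv_mem ψ.2 dirX⟩ _)

/-- The normal has no horizontal component, so the zero extension is weakly differentiable in `x`
against every test function, whatever the trace. -/
lemma green_dirX {d : ℝ} (hd : 0 < d) (f : H1 (strip d)) {φ : ℝ × ℝ → ℂ}
    (hφ : φ ∈ testFunctions) : Green dirX (zeroExt (f.1 0)) (zeroExt (f.1 1)) φ := by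
  rw [Green, integral_zeroExt_mul (measurableSet_strip d),
    integral_zeroExt_mul (measurableSet_strip d)]
  exact eq_neg_of_add_eq_zero_left (integral_mul_pderiv_dirX hd f hφ)

/-- Functions in the form domain satisfy Green's formula without boundary term for test functions
that vanish on the Neumann part of the boundary. -/
lemma green_dirY_of_mem_formDomainA {d δ : ℝ} (hd : 0 < d) {f : H1 (strip d)}
    (hf : f ∈ formDomainA d δ) {φ : ℝ × ℝ → ℂ} (hφ : φ ∈ testFunctions)
    (h : ∀ p : ℝ × ℝ, p.2 = 0 ∨ p.2 = d → p ∉ dirichletA d δ → φ p = 0) :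
    Green dirY (zeroExt (f.1 0)) (zeroExt (f.1 2)) φ := by
  rw [Green, integral_zeroExt_mul (measurableSet_strip d),
    integral_zeroExt_mul (measurableSet_strip d)]
  refine eq_neg_of_add_eq_zero_left ((integral_mul_pderiv_dirY hd f hφ).trans ?_)
  rw [← integral_zero (ℝ × ℝ) ℂ (μ := boundaryMeasure d)]
  refine integral_congr_ae ?_
  filter_upwards [hf, ae_boundaryMeasure d] with p hp hpb
  by_cases hpD : p ∈ dirichletA d δ
  · simp [hp hpD]
  · simp [h p hpb hpD]

lemma smoothCoreA_subset_formDomainA {d : ℝ} (hd : 0 < d) (δ : ℝ) :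
    smoothCoreA d δ ⊆ formDomainA d δ := by
  rintro _ ⟨ψ, hψ, rfl⟩
  change ∀ᵐ p ∂(boundaryMeasure d), p ∈ dirichletA d δ → trace d (toH1 (strip d) ψ) p = 0
  rw [trace_toH1 hd]
  filter_upwards [(testFunctions.memLp ψ.2 (boundaryMeasure d)).coeFn_toLp] with p hp hpD
  exact hp.trans (hψ p hpD)

/-! ### The Dirichlet condition and the junction points -/

/-- The test functions vanishing on a given set. -/
def testFunctionsVanishingOn (D : Set (ℝ × ℝ)) : Submodule ℂ testFunctions where
  carrier := {ψ | ∀ p ∈ D, ψ.1 p = 0}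
  add_mem' := fun {φ ψ} hφ hψ p hp => by
    change φ.1 p + ψ.1 p = 0
    rw [hφ p hp, hψ p hp, add_zero]
  zero_mem' := fun _ _ => rfl
  smul_mem' := fun c ψ hψ p hp => by
    change c • ψ.1 p = 0
    rw [hψ p hp, smul_zero]

lemma zeroExt_strip_eq_zero {d : ℝ} (f : Lp ℂ 2 (volume.restrict (strip d))) {q : ℝ × ℝ}
    (hq : q.2 ≤ 0 ∨ d ≤ q.2) : zeroExt f q = 0 := by
  refine indicator_of_notMem (fun h => ?_) _
  rw [mem_strip] at h
  rcases hq with hq | hq <;> linarith [h.1, h.2]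

section

variable {d δ : ℝ} {W : Fin 3 → ℝ × ℝ → ℂ} {f : H1 (strip d)} {m : ℝ × ℝ → ℂ}

/-- Approximation near the Dirichlet part of the boundary by kernels that sample from outside. -/
lemma pairing_eq_zero_of_vanishing_on_neumann (hd : 0 < d) (hW : ∀ i, MemLp (W i) 2)
    (hWΩ : ∀ i, ∀ p ∉ strip d, W i p = 0)
    (hN : ∀ ψ ∈ testFunctions, ψ ∈ {ψ : ℝ × ℝ → ℂ | ∀ p ∈ dirichletA d δ, ψ p = 0} →
      ∑ i, ∫ p, W i p * jet ψ i p = 0)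
    (hf : f ∈ formDomainA d δ) (hm : m ∈ testFunctions)
    (hmN : ∀ p : ℝ × ℝ, p.2 = 0 ∨ p.2 = d → p ∉ dirichletA d δ → m p = 0)
    {S : Set (ℝ × ℝ)} (hS : IsOpen S)
    (hD : ∀ p ∈ dirichletA d δ, ∀ q, p - q ∈ S → m q * zeroExt (f.1 0) q = 0) :
    ∀ q ∈ closure S, pairing W (fun i => zeroExt (f.1 i)) m q = 0 := by
  refine pairing_eq_zero hW (fun i => memLp_zeroExt (measurableSet_strip d) _) hWΩ hN hm hS
    (fun ρ hρ _ p _ => ?_) (fun ρ hρ _ p _ => ?_)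
    fun ρ _ hρS p hp => mollify_eq_zero hρS (hD p hp)
  · exact green_dirX hd f (testFunctions.mul hm (testFunctions.comp_const_sub hρ p).1)
  · refine green_dirY_of_mem_formDomainA hd hf
      (testFunctions.mul hm (testFunctions.comp_const_sub hρ p).1) fun q hq hqD => ?_
    -- The factor `m` already vanishes on the Neumann part, so no restriction on the side from which
    -- `ρ` samples is needed.
    rw [hmN q hq hqD, zero_mul]

/-- The factor `c` will be `1` on the lower edge and `-1` on the upper one: the shift carries the
zone of vanishing trace past the junction. -/
lemma eq_zero_of_forall_pos_shift {Λ : ℝ × ℝ → ℂ} (hΛ : Continuous Λ) (c : ℝ)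
    (h : ∀ t > 0, Λ (c * t, 0) = 0) : Λ 0 = 0 := by
  have h1 : Tendsto (fun t : ℝ => Λ (c * t, 0)) (𝓝[>] 0) (𝓝 (Λ (c * 0, 0))) :=
    ((hΛ.comp (by fun_prop : Continuous fun t : ℝ => (c * t, (0 : ℝ)))).tendsto 0).mono_left
      nhdsWithin_le_nhds
  have h2 : Tendsto (fun t : ℝ => Λ (c * t, 0)) (𝓝[>] 0) (𝓝 0) :=
    tendsto_const_nhds.congr' (eventually_mem_nhdsWithin.mono fun t ht => (h t ht).symm)
  have h3 := tendsto_nhds_unique h1 h2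
  rwa [mul_zero] at h3

/-- The height `0` may be an endpoint of `[a, b]`, which makes the vector a limit of kernels on a
single side of the horizontal axis. -/
lemma mem_closure_box {x r : ℝ} (hr : 0 < r) {a b : ℝ} (hab : a < b) (h0 : (0 : ℝ) ∈ Icc a b) :
    (x, (0 : ℝ)) ∈ closure (Ioo (x - r) (x + r) ×ˢ Ioo a b) := by
  rw [closure_prod_eq, closure_Ioo (by linarith), closure_Ioo hab.ne]
  exact ⟨⟨by linarith, by linarith⟩, h0⟩

/-- The contribution of the lower edge of the strip. -/
lemma pairing_lower_eq_zero (hd : 0 < d) (hW : ∀ i, MemLp (W i) 2)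
    (hWΩ : ∀ i, ∀ p ∉ strip d, W i p = 0)
    (hN : ∀ ψ ∈ testFunctions, ψ ∈ {ψ : ℝ × ℝ → ℂ | ∀ p ∈ dirichletA d δ, ψ p = 0} →
      ∑ i, ∫ p, W i p * jet ψ i p = 0)
    (hf : f ∈ formDomainA d δ) (hm : m ∈ testFunctions)
    (hm0 : ∀ p : ℝ × ℝ, 2 * d / 3 ≤ p.2 → m p = 0) :
    pairing W (fun i => zeroExt (f.1 i)) m 0 = 0 := by
  have hU : ∀ i, MemLp (zeroExt (f.1 i)) 2 := fun i => memLp_zeroExt (measurableSet_strip d) _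
  refine eq_zero_of_forall_pos_shift (continuous_pairing hW hU hm) 1 fun t ht => ?_
  -- `m₁` vanishes for `x ≥ -δ - t/3`, hence on the lower Neumann part. `m₂` vanishes for `x ≤ -δ -
  -- 2t/3`; a point `p` with `p.1 < -δ` samples only abscissas below `-δ - t + r ≤ -δ - 2t/3`.
  obtain ⟨m₁, hm₁, m₂, hm₂, hadd, h₁, h₂, hzero⟩ :=
    exists_split_horizontal (show -δ - 2 * t / 3 < -δ - t / 3 by linarith) hm
  -- The bound `t / 3` serves the horizontal comparison. The bound `d / 3` keeps points sampled from
  -- the upper edge at height at least `2d/3`, where `m` vanishes.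
  obtain ⟨r, hr, hrt, hrd⟩ : ∃ r > 0, r ≤ t / 3 ∧ r ≤ d / 3 :=
    ⟨min (t / 3) (d / 3), by positivity, min_le_left _ _, min_le_right _ _⟩
  rw [funext hadd, pairing_add hW hU hm₁ hm₂, one_mul]
  have e₁ := pairing_eq_zero_of_vanishing_on_neumann hd hW hWΩ hN hf hm₁
    (S := Ioo (t - r) (t + r) ×ˢ Ioo 0 r) ?_ (isOpen_Ioo.prod isOpen_Ioo) ?_ _
    (mem_closure_box hr hr ⟨le_rfl, hr.le⟩)
  · have e₂ := pairing_eq_zero_of_below hW hWΩ hN f hm₂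
      (snd_lt_of_mem_tsupport hd fun p hp => (hzero p (hm0 p hp)).2)
      (S := Ioo (t - r) (t + r) ×ˢ Ioo (-r) 0) (isOpen_Ioo.prod isOpen_Ioo)
      (fun q hq => hq.2.2) ?_ _ (mem_closure_box hr (neg_lt_zero.2 hr) ⟨by linarith, le_rfl⟩)
    · rw [e₁, e₂, add_zero]
    · intro ρ _ hρS p hp
      refine mollify_eq_zero hρS fun q ⟨⟨hq1, hq2⟩, hq3, hq4⟩ => ?_
      rw [Prod.fst_sub] at hq1 hq2
      rw [Prod.snd_sub] at hq3 hq4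
      rcases hp with ⟨hp1, hp2⟩ | ⟨hp1, hp2⟩
      · rw [h₂ q (by linarith), zero_mul]
      · rw [(hzero q (hm0 q (by linarith))).2, zero_mul]
  · rintro p (hp | hp) hpD
    · refine h₁ p ?_
      by_contra hlt
      exact hpD (Or.inl ⟨by linarith, hp⟩)
    · exact (hzero p (hm0 p (by linarith))).1
  · rintro p hp q ⟨⟨hq1, hq2⟩, hq3, hq4⟩
    rw [Prod.fst_sub] at hq1 hq2
    rw [Prod.snd_sub] at hq3 hq4
    rcases hp with ⟨hp1, hp2⟩ | ⟨hp1, hp2⟩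
    · rw [zeroExt_strip_eq_zero _ (Or.inl (by linarith)), mul_zero]
    · rw [(hzero q (hm0 q (by linarith))).1, zero_mul]

/-- The contribution of the upper edge of the strip. -/
lemma pairing_upper_eq_zero (hd : 0 < d) (hW : ∀ i, MemLp (W i) 2)
    (hWΩ : ∀ i, ∀ p ∉ strip d, W i p = 0)
    (hN : ∀ ψ ∈ testFunctions, ψ ∈ {ψ : ℝ × ℝ → ℂ | ∀ p ∈ dirichletA d δ, ψ p = 0} →
      ∑ i, ∫ p, W i p * jet ψ i p = 0)
    (hf : f ∈ formDomainA d δ) (hm : m ∈ testFunctions)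
    (hm0 : ∀ p : ℝ × ℝ, p.2 ≤ d / 3 → m p = 0) :
    pairing W (fun i => zeroExt (f.1 i)) m 0 = 0 := by
  have hU : ∀ i, MemLp (zeroExt (f.1 i)) 2 := fun i => memLp_zeroExt (measurableSet_strip d) _
  refine eq_zero_of_forall_pos_shift (continuous_pairing hW hU hm) (-1) fun t ht => ?_
  -- Here the roles are exchanged: `m₂` vanishes on the upper Neumann part and is sampled from above
  -- the strip. `m₁` is sampled from below, at abscissas beyond `δ + t - r ≥ δ + 2t/3` when `p.1 >
  -- δ`.
  obtain ⟨m₁, hm₁, m₂, hm₂, hadd, h₁, h₂, hzero⟩ :=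
    exists_split_horizontal (show δ + t / 3 < δ + 2 * t / 3 by linarith) hm
  obtain ⟨r, hr, hrt, hrd⟩ : ∃ r > 0, r ≤ t / 3 ∧ r ≤ d / 3 :=
    ⟨min (t / 3) (d / 3), by positivity, min_le_left _ _, min_le_right _ _⟩
  rw [funext hadd, pairing_add hW hU hm₁ hm₂]
  have e₂ := pairing_eq_zero_of_vanishing_on_neumann hd hW hWΩ hN hf hm₂
    (S := Ioo (-1 * t - r) (-1 * t + r) ×ˢ Ioo (-r) 0) ?_ (isOpen_Ioo.prod isOpen_Ioo) ?_ _
    (mem_closure_box hr (neg_lt_zero.2 hr) ⟨by linarith, le_rfl⟩)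
  · have e₁ := pairing_eq_zero_of_above hW hWΩ hN f hm₁
      (snd_pos_of_mem_tsupport hd fun p hp => (hzero p (hm0 p hp)).1)
      (S := Ioo (-1 * t - r) (-1 * t + r) ×ˢ Ioo 0 r) (isOpen_Ioo.prod isOpen_Ioo)
      (fun q hq => hq.2.1) ?_ _ (mem_closure_box hr hr ⟨le_rfl, hr.le⟩)
    · rw [e₁, e₂, add_zero]
    · intro ρ _ hρS p hp
      refine mollify_eq_zero hρS fun q ⟨⟨hq1, hq2⟩, hq3, hq4⟩ => ?_
      rw [Prod.fst_sub] at hq1 hq2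
      rw [Prod.snd_sub] at hq3 hq4
      rcases hp with ⟨hp1, hp2⟩ | ⟨hp1, hp2⟩
      · rw [(hzero q (hm0 q (by linarith))).1, zero_mul]
      · rw [h₁ q (by linarith), zero_mul]
  · rintro p (hp | hp) hpD
    · exact (hzero p (hm0 p (by linarith))).2
    · refine h₂ p ?_
      by_contra hlt
      exact hpD (Or.inr ⟨by linarith, hp⟩)
  · rintro p hp q ⟨⟨hq1, hq2⟩, hq3, hq4⟩
    rw [Prod.fst_sub] at hq1 hq2
    rw [Prod.snd_sub] at hq3 hq4
    rcases hp with ⟨hp1, hp2⟩ | ⟨hp1, hp2⟩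
    · rw [(hzero q (hm0 q (by linarith))).2, zero_mul]
    · rw [zeroExt_strip_eq_zero _ (Or.inr (by linarith)), mul_zero]

end

lemma formDomainA_subset_closure_smoothCoreA {d : ℝ} (hd : 0 < d) (δ : ℝ) :
    formDomainA d δ ⊆ closure (smoothCoreA d δ) := by
  intro f hf
  have hcore : smoothCoreA d δ
      = toH1 (strip d) '' (testFunctionsVanishingOn (dirichletA d δ) : Set testFunctions) := rfl
  rw [hcore]
  refine mem_closure_of_forall_annihilator (measurableSet_strip d) _ f fun W hW hWΩ hN => ?_
  have hN' : ∀ ψ ∈ testFunctions, ψ ∈ {ψ : ℝ × ℝ → ℂ | ∀ p ∈ dirichletA d δ, ψ p = 0} →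
      ∑ i, ∫ p, W i p * jet ψ i p = 0 := fun ψ hψ hψD => hN ⟨ψ, hψ⟩ hψD
  have hU : ∀ i, MemLp (zeroExt (f.1 i)) 2 := fun i => memLp_zeroExt (measurableSet_strip d) _
  refine sum_integral_eq_zero_of_pairing hW hU fun θ hθ => ?_
  obtain ⟨m, hm, m', hm', hadd, h0, h0'⟩ := exists_split_vertical hd hθ
  rw [funext hadd, pairing_add hW hU hm hm', pairing_lower_eq_zero hd hW hWΩ hN' hf hm h0,
    pairing_upper_eq_zero hd hW hWΩ hN' hf hm' h0', add_zero]

end Waveguide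

end

theorem mainTheorem6 (d δ : ℝ) (hd : 0 < d) (hδ : 0 < δ) :
    Waveguide.smoothCoreA d δ ⊆ Waveguide.formDomainA d δ ∧
      Waveguide.formDomainA d δ ⊆ closure (Waveguide.smoothCoreA d δ) :=
  ⟨Waveguide.smoothCoreA_subset_formDomainA hd δ,
    Waveguide.formDomainA_subset_closure_smoothCoreA hd δ⟩
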